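/- **Theorem 5.2.** Let $M$ be a compact connected smooth manifold without boundary, $g$ a smooth Riemannian metric on $M$, and $H\subset TM$ a smooth subbundle of constant rank which is $r$-step bracket generating for some $r\ge 2$ (the smooth local sections of $H$, together with their iterated Lie brackets of length at most $r$, span every tangent space). Let $g_H=g|_H$, let $V=H^{\perp}$, let $\pi_H,\pi_V$ be the orthogonal projections onto $H,V$, and let $\nabla^R$ be the Levi-Civita connection of $g$. Let $(N,h)$ be a compact smooth Riemannian manifold without boundary, with Levi-Civita connection $\widetilde\nabla$. The generalized Bott connection $\nabla^{\mathfrak B}$ on $TM$ is $$\nabla^{\mathfrak B}_XY=\begin{cases}\pi_H(\nabla^R_XY), & X,Y\in\Gamma(H),\\ \pi_H([X,Y]), & X\in\Gamma(V),\ Y\in\Gamma(H),\\ \pi_V([X,Y]), & X\in\Gamma(H),\ Y\in\Gamma(V),\\ \pi_V(\nabla^R_XY), & X,Y\in\Gamma(V).\end{cases}$$ For a smooth map $f:M\to N$ let $\beta_f(X,Y)=\widetilde\nabla^{f}_Y\,df(X)-df(\nabla^{\mathfrak B}_YX)$, where $\widetilde\nabla^f$ is the pull-back of $\widetilde\nabla$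 to $f^{-1}TN$, and let $$\tau_H(f)=\sum_{i}\beta_f(e_i,e_i)-df(\zeta),\qquad \zeta=\pi_H\Big(\sum_\alpha\nabla^R_{e_\alpha}e_\alpha\Big),$$ where $(e_i)$ and $(e_\alpha)$ are local orthonormal frames of $H$ and $V$. Let $\varphi:M\to N$ be smooth and $0<\delta\le\infty$. A solution on $M\times[0,\delta)$ of the subelliptic harmonic map heat flow with initial map $\varphi$ is a map $u:M\times[0,\delta)\to N$ that is continuous on $M\times[0,\delta)$, is smooth on $M\times(0,\delta)$, and satisfies $$\frac{\partial u}{\partial t}=\tau_H\big(u(\cdot,t)\big)\ \text{ on } M\times(0,\delta),\qquad u(x,0)=\varphi(x)\ \text{ for all } x\in M .$$ If $u$ and $v$ are two solutions on $M\times[0,\delta)$ with the same initial map $\varphi$, then $u(x,t)=v(x,t)$ for all $(x,t)\in M\times[0,\delta)$. -/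

import Mathlib

open Bundle Set VectorField
open scoped Manifold ContDiff Topology

namespace SubRiem

set_option linter.unusedSectionVars false

noncomputable section

section LeviCivita

variable {E : Type*} [NormedAddCommGroup E] [NormedSpace ℝ E] [FiniteDimensional ℝ E]
  {M : Type*} [TopologicalSpace M] [ChartedSpace E M] [IsManifold 𝓘(ℝ, E) ∞ M]
  [RiemannianBundle (fun x : M ↦ TangentSpace 𝓘(ℝ, E) x)]

/-- Right-hand side of the Koszul formula for `2 ⟨∇_X Y, Z⟩` at `x`. -/
def koszul (X Y Z : ∀ x : M, TangentSpace 𝓘(ℝ, E) x) (x : M) : ℝ :=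
  mvfderiv 𝓘(ℝ, E) (fun p ↦ inner ℝ (Y p) (Z p)) x (X x)
    + mvfderiv 𝓘(ℝ, E) (fun p ↦ inner ℝ (X p) (Z p)) x (Y x)
    - mvfderiv 𝓘(ℝ, E) (fun p ↦ inner ℝ (X p) (Y p)) x (Z x)
    + inner ℝ (mlieBracket 𝓘(ℝ, E) X Y x) (Z x)
    - inner ℝ (mlieBracket 𝓘(ℝ, E) X Z x) (Y x)
    - inner ℝ (mlieBracket 𝓘(ℝ, E) Y Z x) (X x)

variable [IsContMDiffRiemannianBundle 𝓘(ℝ, E) ∞ E (fun x : M ↦ TangentSpace 𝓘(ℝ, E) x)]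

theorem mdiff_inner {Y Z : ∀ x : M, TangentSpace 𝓘(ℝ, E) x} {x : M}
    (hY : MDiffAt (T% Y) x) (hZ : MDiffAt (T% Z) x) :
    MDiffAt (fun p ↦ inner ℝ (Y p) (Z p)) x :=
  have : IsContMDiffRiemannianBundle 𝓘(ℝ, E) 1 E (fun x : M ↦ TangentSpace 𝓘(ℝ, E) x) :=
    inferInstance
  MDifferentiableAt.inner_bundle (F := E) (E := fun x : M ↦ TangentSpace 𝓘(ℝ, E) x)
    (b := fun x ↦ x) hY hZ

theorem koszul_tensorial_left {Y Z : ∀ x : M, TangentSpace 𝓘(ℝ, E) x} {x : M}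
    (hY : MDiffAt (T% Y) x) (hZ : MDiffAt (T% Z) x) :
    TensorialAt 𝓘(ℝ, E) E (fun X ↦ koszul X Y Z x) x where
  smul {f X} hf hX := by
    have h1 := mvfderiv_mul hf (mdiff_inner hX hZ)
    have h2 := mvfderiv_mul hf (mdiff_inner hX hY)
    have e1 : (fun p ↦ inner ℝ ((f • X) p) (Z p)) = f * fun p ↦ inner ℝ (X p) (Z p) := by
      ext p; simp [inner_smul_left]
    have e2 : (fun p ↦ inner ℝ ((f • X) p) (Y p)) = f * fun p ↦ inner ℝ (X p) (Y p) := by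
      ext p; simp [inner_smul_left]
    simp only [koszul, e1, e2, h1, h2, mlieBracket_smul_left hf hX]
    simp [inner_add_left, inner_smul_left, inner_smul_right]
    ring
  add {X X'} hX hX' := by
    have h1 := mvfderiv_add (mdiff_inner hX hZ) (mdiff_inner hX' hZ)
    have h2 := mvfderiv_add (mdiff_inner hX hY) (mdiff_inner hX' hY)
    have e1 : (fun p ↦ inner ℝ ((X + X') p) (Z p)) =
        (fun p ↦ inner ℝ (X p) (Z p)) + fun p ↦ inner ℝ (X' p) (Z p) := by
      ext p; simp [inner_add_left]
    have e2 : (fun p ↦ inner ℝ ((X + X') p) (Y p)) =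
        (fun p ↦ inner ℝ (X p) (Y p)) + fun p ↦ inner ℝ (X' p) (Y p) := by
      ext p; simp [inner_add_left]
    simp only [koszul, e1, e2, h1, h2, mlieBracket_add_left hX hX']
    simp [inner_add_left, inner_add_right]
    ring

theorem koszul_tensorial_right {X Y : ∀ x : M, TangentSpace 𝓘(ℝ, E) x} {x : M}
    (hX : MDiffAt (T% X) x) (hY : MDiffAt (T% Y) x) :
    TensorialAt 𝓘(ℝ, E) E (fun Z ↦ koszul X Y Z x) x where
  smul {f Z} hf hZ := by
    have h1 := mvfderiv_mul hf (mdiff_inner hY hZ)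
    have h2 := mvfderiv_mul hf (mdiff_inner hX hZ)
    have e1 : (fun p ↦ inner ℝ (Y p) ((f • Z) p)) = f * fun p ↦ inner ℝ (Y p) (Z p) := by
      ext p; simp [inner_smul_right]
    have e2 : (fun p ↦ inner ℝ (X p) ((f • Z) p)) = f * fun p ↦ inner ℝ (X p) (Z p) := by
      ext p; simp [inner_smul_right]
    simp only [koszul, e1, e2, h1, h2, mlieBracket_smul_right hf hZ]
    simp [inner_add_left, inner_smul_left, inner_smul_right]
    rw [real_inner_comm (Z x) (Y x), real_inner_comm (Z x) (X x)]
    ring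
  add {Z Z'} hZ hZ' := by
    have h1 := mvfderiv_add (mdiff_inner hY hZ) (mdiff_inner hY hZ')
    have h2 := mvfderiv_add (mdiff_inner hX hZ) (mdiff_inner hX hZ')
    have e1 : (fun p ↦ inner ℝ (Y p) ((Z + Z') p)) =
        (fun p ↦ inner ℝ (Y p) (Z p)) + fun p ↦ inner ℝ (Y p) (Z' p) := by
      ext p; simp [inner_add_right]
    have e2 : (fun p ↦ inner ℝ (X p) ((Z + Z') p)) =
        (fun p ↦ inner ℝ (X p) (Z p)) + fun p ↦ inner ℝ (X p) (Z' p) := by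
      ext p; simp [inner_add_right]
    simp only [koszul, e1, e2, h1, h2, mlieBracket_add_right hZ hZ']
    simp [inner_add_left, inner_add_right]
    ring

instance (x : M) : FiniteDimensional ℝ (TangentSpace 𝓘(ℝ, E) x) :=
  inferInstanceAs (FiniteDimensional ℝ E)

/-- The Riemannian (Levi-Civita) connection as an operator: `⟨(∇ Y)(x) v, w⟩` is half of the Koszul
expression for vector fields with values `v`, `w` at `x` (the choice of these does not matter, since
the expression is tensorial). -/
def leviCivitaFun (Y : ∀ x : M, TangentSpace 𝓘(ℝ, E) x) (x : M) :
    TangentSpace 𝓘(ℝ, E) x →L[ℝ] TangentSpace 𝓘(ℝ, E) x :=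
  open Classical in
  if hY : MDiffAt (T% Y) x then
    haveI : CompleteSpace (TangentSpace 𝓘(ℝ, E) x) := FiniteDimensional.complete ℝ _
    (1 / 2 : ℝ) • ((InnerProductSpace.toDual ℝ
        (TangentSpace 𝓘(ℝ, E) x)).symm.toContinuousLinearEquiv.toContinuousLinearMap ∘L
      TensorialAt.mkHom₂ (fun X Z ↦ koszul X Y Z x) x
        (fun _ hZ ↦ koszul_tensorial_left hY hZ) (fun _ hX ↦ koszul_tensorial_right hX hY))
  else 0

theorem inner_leviCivitaFun {X Y Z : ∀ x : M, TangentSpace 𝓘(ℝ, E) x} {x : M}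
    (hX : MDiffAt (T% X) x) (hY : MDiffAt (T% Y) x) (hZ : MDiffAt (T% Z) x) :
    inner ℝ (leviCivitaFun Y x (X x)) (Z x) = koszul X Y Z x / 2 := by
  have : CompleteSpace (TangentSpace 𝓘(ℝ, E) x) := FiniteDimensional.complete ℝ _
  have h := TensorialAt.mkHom₂_apply (Φ := fun X Z ↦ koszul X Y Z x)
    (fun _ hZ ↦ koszul_tensorial_left hY hZ) (fun _ hX ↦ koszul_tensorial_right hX hY) hX hZ
  rw [leviCivitaFun, dif_pos hY]
  simp only [smul_apply, inner_smul_left]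
  refine (congrArg _ ((InnerProductSpace.toDual_symm_apply
    (𝕜 := ℝ) (E := TangentSpace 𝓘(ℝ, E) x)).trans h)).trans ?_
  simp only [conj_trivial]
  ring

theorem ext_inner_field {x : M} {v w : TangentSpace 𝓘(ℝ, E) x}
    (h : ∀ Z : ∀ p : M, TangentSpace 𝓘(ℝ, E) p, MDiffAt (T% Z) x →
      inner ℝ v (Z x) = inner ℝ w (Z x)) : v = w := by
  refine ext_inner_right ℝ fun z ↦ ?_
  have := h (FiberBundle.extend E z) (FiberBundle.mdifferentiableAt_extend 𝓘(ℝ, E) E z)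
  simpa using this

/-- The Riemannian (Levi-Civita) connection of `M`; `leviCivita Y x v` is `(∇_v Y)(x)`. It is torsion
free and compatible with the metric, as shown below. -/
def leviCivita : CovariantDerivative 𝓘(ℝ, E) E (fun x : M ↦ TangentSpace 𝓘(ℝ, E) x) where
  toFun := leviCivitaFun
  isCovariantDerivativeOnUniv :=
    { add := by
        intro Y Y' x hY hY' _
        ext1 v
        refine ext_inner_field fun Z hZ ↦ ?_
        have hX := FiberBundle.mdifferentiableAt_extend 𝓘(ℝ, E) E v
        have h := inner_leviCivitaFun hX (mdifferentiableAt_add_section hY hY') hZ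
        have h1 := inner_leviCivitaFun hX hY hZ
        have h2 := inner_leviCivitaFun hX hY' hZ
        have e1 : (fun p ↦ inner ℝ ((Y + Y') p) (Z p)) =
            (fun p ↦ inner ℝ (Y p) (Z p)) + fun p ↦ inner ℝ (Y' p) (Z p) := by
          ext p; simp [inner_add_left]
        have e2 : (fun p ↦ inner ℝ (FiberBundle.extend E v p) ((Y + Y') p)) =
            (fun p ↦ inner ℝ (FiberBundle.extend E v p) (Y p)) +
              fun p ↦ inner ℝ (FiberBundle.extend E v p) (Y' p) := by
          ext p; simp [inner_add_right]
        have k1 := mvfderiv_add (mdiff_inner hY hZ) (mdiff_inner hY' hZ)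
        have k2 := mvfderiv_add (mdiff_inner hX hY) (mdiff_inner hX hY')
        simp only [FiberBundle.extend_apply_self] at h h1 h2
        refine h.trans ?_
        rw [add_apply, inner_add_left, h1, h2]
        simp only [koszul, e1, e2, k1, k2, mlieBracket_add_left hY hY',
          mlieBracket_add_right hY hY']
        simp [inner_add_left, inner_add_right]
        ring
      leibniz := by
        intro Y f x hY hf _
        ext1 v
        refine ext_inner_field fun Z hZ ↦ ?_
        have hX := FiberBundle.mdifferentiableAt_extend 𝓘(ℝ, E) E v
        have h := inner_leviCivitaFun hX (hf.smul_section hY) hZ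
        have h1 := inner_leviCivitaFun hX hY hZ
        have e1 : (fun p ↦ inner ℝ ((f • Y) p) (Z p)) = f * fun p ↦ inner ℝ (Y p) (Z p) := by
          ext p; simp [inner_smul_left]
        have e2 : (fun p ↦ inner ℝ (FiberBundle.extend E v p) ((f • Y) p)) =
            f * fun p ↦ inner ℝ (FiberBundle.extend E v p) (Y p) := by
          ext p; simp [inner_smul_right]
        have k1 := mvfderiv_mul hf (mdiff_inner hY hZ)
        have k2 := mvfderiv_mul hf (mdiff_inner hX hY)
        simp only [FiberBundle.extend_apply_self] at h h1
        refine h.trans ?_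
        rw [add_apply, inner_add_left, smul_apply, inner_smul_left, h1]
        simp only [koszul, e1, e2, k1, k2, mlieBracket_smul_left hf hY,
          mlieBracket_smul_right hf hY]
        simp [inner_add_left, inner_smul_left, inner_smul_right]
        try rw [real_inner_comm v (Y x)]
        ring }

theorem leviCivita_torsion {X Y : ∀ x : M, TangentSpace 𝓘(ℝ, E) x} {x : M}
    (hX : MDiffAt (T% X) x) (hY : MDiffAt (T% Y) x) :
    leviCivita Y x (X x) - leviCivita X x (Y x) = mlieBracket 𝓘(ℝ, E) X Y x := by
  refine ext_inner_field fun Z hZ ↦ ?_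
  have h1 := inner_leviCivitaFun hX hY hZ
  have h2 := inner_leviCivitaFun hY hX hZ
  have e : (fun p ↦ inner ℝ (X p) (Y p)) = fun p ↦ inner ℝ (Y p) (X p) := by
    ext p; exact real_inner_comm _ _
  rw [inner_sub_left]
  refine (congrArg₂ _ h1 h2).trans ?_
  rw [koszul, koszul, mlieBracket_swap_apply (V := Y) (W := X), inner_neg_left, e]
  ring

theorem leviCivita_metric {X Y Z : ∀ x : M, TangentSpace 𝓘(ℝ, E) x} {x : M}
    (hX : MDiffAt (T% X) x) (hY : MDiffAt (T% Y) x) (hZ : MDiffAt (T% Z) x) :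
    mvfderiv 𝓘(ℝ, E) (fun p ↦ inner ℝ (Y p) (Z p)) x (X x) =
      inner ℝ (leviCivita Y x (X x)) (Z x) + inner ℝ (Y x) (leviCivita Z x (X x)) := by
  have h1 := inner_leviCivitaFun hX hY hZ
  have h2 := inner_leviCivitaFun hX hZ hY
  have e : (fun p ↦ inner ℝ (Z p) (Y p)) = fun p ↦ inner ℝ (Y p) (Z p) := by
    ext p; exact real_inner_comm _ _
  rw [real_inner_comm (leviCivita Z x (X x)) (Y x)]
  refine Eq.symm ((congrArg₂ _ h1 h2).trans ?_)
  rw [koszul, koszul, mlieBracket_swap_apply (V := Z) (W := Y), inner_neg_left, e]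
  ring

end LeviCivita

/-! ### Horizontal distributions -/

section Horizontal

variable {E : Type*} [NormedAddCommGroup E] [NormedSpace ℝ E] [FiniteDimensional ℝ E]
  {M : Type*} [TopologicalSpace M] [ChartedSpace E M] [IsManifold 𝓘(ℝ, E) ∞ M]

/-- `bracketFields H U j` is the space `Γ^j(U, H)`: `Γ^1(U, H)` consists of the vector fields that
are smooth on `U` with values in `H` there, and `Γ^(j+1) = Γ^j + [Γ^1, Γ^j]`. Fields are functions
on all of `M`, only their restriction to the open set `U` matters. -/
def bracketFields (H : ∀ x : M, Submodule ℝ (TangentSpace 𝓘(ℝ, E) x)) (U : Set M) :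
    ℕ → Submodule ℝ (∀ x : M, TangentSpace 𝓘(ℝ, E) x)
  | 0 => ⊥
  | 1 => Submodule.span ℝ {X | CMDiff[U] ∞ (T% X) ∧ ∀ y ∈ U, X y ∈ H y}
  | (j + 2) => bracketFields H U (j + 1) ⊔
      Submodule.span ℝ {Z | ∃ X ∈ bracketFields H U 1, ∃ Y ∈ bracketFields H U (j + 1),
        Z = mlieBracket 𝓘(ℝ, E) X Y}

/-- `H` is `r`-step bracket generating: near every point, the values of `Γ^r(U, H)` exhaust the
tangent space. -/
def IsBracketGenerating (H : ∀ x : M, Submodule ℝ (TangentSpace 𝓘(ℝ, E) x)) (r : ℕ) : Prop :=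
  ∀ (x : M) (U : Set M), IsOpen U → x ∈ U →
    ∀ v : TangentSpace 𝓘(ℝ, E) x, ∃ X ∈ bracketFields H U r, X x = v

variable (E M) in
/-- A horizontal distribution on `M`: a smooth subbundle `H` of the tangent bundle, of constant
rank, that is `r`-step bracket generating for some `r ≥ 2`. On a manifold with a fixed Riemannian
metric `g`, the sub-Riemannian metric is `g_H = g|_H`, so that `(M, H, g_H; g)` is the same thing
as the Riemannian manifold `(M, g)` together with `H`. -/
structure HorizontalDistribution where
  fiber : ∀ x : M, Submodule ℝ (TangentSpace 𝓘(ℝ, E) x)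
  rank : ℕ
  exists_frame : ∀ x : M, ∃ U : Set M, IsOpen U ∧ x ∈ U ∧
    ∃ X : Fin rank → ∀ y : M, TangentSpace 𝓘(ℝ, E) y,
      (∀ i, CMDiff[U] ∞ (T% (X i))) ∧
      ∀ y ∈ U, LinearIndependent ℝ (fun i ↦ X i y) ∧
        Submodule.span ℝ (Set.range fun i ↦ X i y) = fiber y
  exists_step : ∃ r : ℕ, 2 ≤ r ∧ IsBracketGenerating fiber r

end Horizontal

/-! ### The subelliptic tension field -/

section Tension

variable {E : Type*} [NormedAddCommGroup E] [NormedSpace ℝ E] [FiniteDimensional ℝ E]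
  {M : Type*} [TopologicalSpace M] [ChartedSpace E M] [IsManifold 𝓘(ℝ, E) ∞ M]
  [RiemannianBundle (fun x : M ↦ TangentSpace 𝓘(ℝ, E) x)]
  [IsContMDiffRiemannianBundle 𝓘(ℝ, E) ∞ E (fun x : M ↦ TangentSpace 𝓘(ℝ, E) x)]
  {F : Type*} [NormedAddCommGroup F] [NormedSpace ℝ F] [FiniteDimensional ℝ F]
  {N : Type*} [TopologicalSpace N] [ChartedSpace F N] [IsManifold 𝓘(ℝ, F) ∞ N]
  [RiemannianBundle (fun y : N ↦ TangentSpace 𝓘(ℝ, F) y)]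
  [IsContMDiffRiemannianBundle 𝓘(ℝ, F) ∞ F (fun y : N ↦ TangentSpace 𝓘(ℝ, F) y)]

/-- The horizontal part `π_H X` of a vector field. -/
def projH (H : HorizontalDistribution E M) (X : ∀ x : M, TangentSpace 𝓘(ℝ, E) x) (x : M) :
    TangentSpace 𝓘(ℝ, E) x :=
  (H.fiber x).starProjection (X x)

/-- The vertical part `π_V X` of a vector field, where `V` is the orthogonal complement of `H`. -/
def projV (H : HorizontalDistribution E M) (X : ∀ x : M, TangentSpace 𝓘(ℝ, E) x) (x : M) :
    TangentSpace 𝓘(ℝ, E) x :=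
  (H.fiber x)ᗮ.starProjection (X x)

/-- The generalized Bott connection `∇^𝔅_X Y`, obtained by splitting `X` and `Y` into horizontal
and vertical parts. -/
def bottConnection (H : HorizontalDistribution E M) (X Y : ∀ x : M, TangentSpace 𝓘(ℝ, E) x) :
    ∀ x : M, TangentSpace 𝓘(ℝ, E) x :=
  projH H (fun p ↦ leviCivita (projH H Y) p (projH H X p))
    + projH H (mlieBracket 𝓘(ℝ, E) (projV H X) (projH H Y))
    + projV H (mlieBracket 𝓘(ℝ, E) (projH H X) (projV H Y))
    + projV H (fun p ↦ leviCivita (projV H Y) p (projV H X p))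

/-- The covariant derivative `∇̃^f_w s` of a section `s` of `f⁻¹TN` at `x` in the direction `w`, for
the pull-back of the Riemannian connection of `N`. With `s = ∑ sᵏ (E_k ∘ f)` in the coordinate frame
`E_k` of a local trivialization of `TN` around `f x`, it is
`∑ (w sᵏ) E_k + ∇̃_{df(w)} (∑ sᵏ(x) E_k)`. -/
def pullbackConnection (f : M → N) (s : ∀ p : M, TangentSpace 𝓘(ℝ, F) (f p)) (x : M)
    (w : TangentSpace 𝓘(ℝ, E) x) : TangentSpace 𝓘(ℝ, F) (f x) :=
  (trivializationAt F (fun y : N ↦ TangentSpace 𝓘(ℝ, F) y) (f x)).symm (f x)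
      (mvfderiv 𝓘(ℝ, E) (fun p ↦ (trivializationAt F (fun y : N ↦ TangentSpace 𝓘(ℝ, F) y) (f x)
        ⟨f p, s p⟩).2) x w)
    + leviCivita (FiberBundle.extend F (s x)) (f x) (mfderiv 𝓘(ℝ, E) 𝓘(ℝ, F) f x w)

/-- The second fundamental form `β(X, Y) = ∇̃^f_Y df(X) - df(∇^𝔅_Y X)` of `f` with respect to the
generalized Bott connection of `M` and the Riemannian connection of `N`. It is tensorial, so its
value on `v, w` at `x` is computed with smooth vector fields extending `v` and `w`. -/
def secondFundamentalForm (H : HorizontalDistribution E M) (f : M → N) (x : M)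
    (v w : TangentSpace 𝓘(ℝ, E) x) : TangentSpace 𝓘(ℝ, F) (f x) :=
  pullbackConnection f (fun p ↦ mfderiv 𝓘(ℝ, E) 𝓘(ℝ, F) f p (FiberBundle.extend E v p)) x w
    - mfderiv 𝓘(ℝ, E) 𝓘(ℝ, F) f x
        (bottConnection H (FiberBundle.extend E w) (FiberBundle.extend E v) x)

/-- The mean curvature vector `ζ = π_H (∑_α ∇_{e_α} e_α)` of the vertical distribution, with
`(e_α)` an orthonormal frame of `V`. For vertical fields `(X, Y) ↦ π_H (∇_X Y)` is tensorial, so an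
orthonormal basis of `V_x` and vertical fields extending it are enough. -/
def meanCurvature (H : HorizontalDistribution E M) (x : M) : TangentSpace 𝓘(ℝ, E) x :=
  (H.fiber x).starProjection (∑ α, leviCivita
    (projV H (FiberBundle.extend E (stdOrthonormalBasis ℝ (H.fiber x)ᗮ α : TangentSpace 𝓘(ℝ, E) x)))
    x (stdOrthonormalBasis ℝ (H.fiber x)ᗮ α))

/-- The subelliptic tension field `τ_H(f) = ∑_i β(e_i, e_i) - df(ζ)`, with `(e_i)` an orthonormal
basis of `H_x`. -/
def tensionField (H : HorizontalDistribution E M) (f : M → N) (x : M) :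
    TangentSpace 𝓘(ℝ, F) (f x) :=
  ∑ i, secondFundamentalForm H f x (stdOrthonormalBasis ℝ (H.fiber x) i : TangentSpace 𝓘(ℝ, E) x)
      (stdOrthonormalBasis ℝ (H.fiber x) i)
    - mfderiv 𝓘(ℝ, E) 𝓘(ℝ, F) f x (meanCurvature H x)

variable (F) in
/-- `u` solves the subelliptic harmonic map heat flow `∂u/∂t = τ_H(u)`, `u|_{t=0} = φ`, on
`M × [0, δ)` (`0 < δ ≤ ∞`): it is continuous on `M × [0, δ)`, smooth on `M × (0, δ)`, satisfies the
equation there, and has initial value `φ`. Values of `u` at other times play no role. -/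
structure IsHeatFlow (H : HorizontalDistribution E M) (δ : EReal) (φ : M → N) (u : M → ℝ → N) :
    Prop where
  continuousOn : ContinuousOn (fun p : M × ℝ ↦ u p.1 p.2) {p | 0 ≤ p.2 ∧ (p.2 : EReal) < δ}
  contMDiffOn : ContMDiffOn (𝓘(ℝ, E).prod 𝓘(ℝ, ℝ)) 𝓘(ℝ, F) ∞ (fun p : M × ℝ ↦ u p.1 p.2)
    {p | 0 < p.2 ∧ (p.2 : EReal) < δ}
  equation : ∀ (x : M) (t : ℝ), 0 < t → (t : EReal) < δ →
    (mfderiv 𝓘(ℝ, ℝ) 𝓘(ℝ, F) (u x) t (1 : ℝ) : TangentSpace 𝓘(ℝ, F) (u x t)) =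
      tensionField H (fun p ↦ u p t) x
  initial : ∀ x : M, u x 0 = φ x

end Tension

end

end SubRiem

/-! Choose a smooth embedding `h` of `N` into a Euclidean space; it need not be isometric. The
differential of `h` turns the tension field into a degenerate linear operator minus a quadratic term
(`mvfderiv_tensionField`): second derivatives of `h ∘ f` along an orthonormal basis `e_i` of `H_x`,
minus `hess h (df e_i) (df e_i)`, minus a first order drift. Here `hess` is built with the
connection of `N`, and this is the only way the metric of `N` enters.

Let `w = h ∘ u - h ∘ v`, and let `α_i`, `β_i` be the derivatives of `h ∘ u`, `h ∘ v` along `e_i`.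
Compactness of `N` gives `|⟨w, hess_u - hess_v⟩| ≤ |α_i - β_i|² + C |w|² (|α_i|² + |β_i|²)` in each
direction (`exists_hess_bounds`). The first term is absorbed by the second derivative of `|w|²`. The
second cannot be handled by a maximum principle for `|w|²` alone: solutions are only continuous at
time `0`, so their gradients have no a priori bound there.

The remedy is the weight `exp (L (|h u - h p|² + |h v - h p|²) - K t)`, where `p` is a fixed smooth
map with `h ∘ p` uniformly within a small `η` of both `h ∘ u` and `h ∘ v`. Its exponent contributes
`-L |w|² (|α_i|² + |β_i|²)`, up to gradients of `p` and terms that are small when `η` is. For `L = 2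
C + 2` all gradients of `u` and `v` cancel, and at a positive spatial maximum `K` is bounded in
terms of `C`, `η` and `p` (`direction_estimate`, `growth_rate_le`). A larger `K` rules out such a
maximum (`eq_of_close`). Only second derivatives along `H` and a first derivative along the drift
are used, so the degeneracy of the operator does no harm.

A map `p` exists on short time intervals: if `u` and `v` agree at `t₀`, take a slice of `u` slightly
later. Agreement therefore propagates forward from each time of agreement
(`IsHeatFlow.exists_eq_later`), and since the set of times of agreement is closed it reaches every
time (`IsHeatFlow.eq_of_embedding`). -/

namespace SubRiem

set_option linter.unusedSectionVars false

/-! ### One-variable conditions at a maximum of a weighted squared distance. -/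

section Calculus

/-- The second derivative is nonpositive at a local maximum. -/
theorem second_deriv_nonpos_of_isLocalMax {f f' : ℝ → ℝ} {f'' x : ℝ}
    (hf : ∀ᶠ s in 𝓝 x, HasDerivAt f (f' s) s) (hf' : HasDerivAt f' f'' x)
    (hmax : IsLocalMax f x) : f'' ≤ 0 := by
  by_contra! hpos
  have hd : deriv f =ᶠ[𝓝 x] f' := hf.mono fun s hs ↦ hs.deriv
  have hdd : deriv (deriv f) x = f'' := by rw [hd.deriv_eq, hf'.deriv]
  -- The second derivative test makes `x` a local minimum as well, so `f` is locally constant and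
  -- its second derivative vanishes.
  have hmin : IsLocalMin f x := isLocalMin_of_deriv_deriv_pos (hdd ▸ hpos) hmax.deriv_eq_zero
    hf.self_of_nhds.continuousAt
  have hc : f =ᶠ[𝓝 x] fun _ ↦ f x := by
    filter_upwards [hmax, hmin] with s h1 h2 using le_antisymm h1 h2
  have h0 : deriv f =ᶠ[𝓝 x] fun _ ↦ 0 := by
    refine hc.deriv.trans ?_
    filter_upwards with s using by simp
  rw [h0.deriv_eq] at hdd
  simp at hdd
  exact hpos.ne hdd

/-- A function with a left-sided maximum has nonnegative derivative. -/
theorem deriv_nonneg_of_max_left {f : ℝ → ℝ} {f' x a : ℝ} (hax : a < x) (hf : HasDerivAt f f' x)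
    (hmax : ∀ s ∈ Icc a x, f s ≤ f x) : 0 ≤ f' := by
  have h := (hasDerivWithinAt_iff_tendsto_slope.1 (hf.hasDerivWithinAt (s := Iio x)))
  rw [sdiff_singleton_eq_self (by simp)] at h
  refine ge_of_tendsto h ?_
  filter_upwards [Ioo_mem_nhdsLT hax] with s hs
  rw [slope_def_field]
  exact div_nonneg_of_nonpos (by linarith [hmax s ⟨hs.1.le, hs.2.le⟩]) (by linarith [hs.2])

/-- First derivative of `q * exp (L * g)` at a local maximum. -/
theorem weighted_max_first {q g : ℝ → ℝ} {q' g' L x : ℝ}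
    (hq : HasDerivAt q q' x) (hg : HasDerivAt g g' x)
    (hmax : IsLocalMax (fun s ↦ q s * Real.exp (L * g s)) x) :
    q' + L * q x * g' = 0 := by
  have h := hmax.hasDerivAt_eq_zero (hq.mul (hg.const_mul L).exp)
  have he := Real.exp_pos (L * g x)
  have : (q' + L * q x * g') * Real.exp (L * g x) = 0 := by linarith
  exact (mul_eq_zero.1 this).resolve_right he.ne'

/-- Second order condition for `q * exp (L * g)` at a local maximum. -/
theorem weighted_max_second {q g q' g' : ℝ → ℝ} {q'' g'' L x : ℝ}
    (hq : ∀ᶠ s in 𝓝 x, HasDerivAt q (q' s) s) (hg : ∀ᶠ s in 𝓝 x, HasDerivAt g (g' s) s)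
    (hq' : HasDerivAt q' q'' x) (hg' : HasDerivAt g' g'' x)
    (hmax : IsLocalMax (fun s ↦ q s * Real.exp (L * g s)) x) :
    q'' + L * q x * g'' - L ^ 2 * q x * g' x ^ 2 ≤ 0 := by
  have h1 := weighted_max_first hq.self_of_nhds hg.self_of_nhds hmax
  -- With the exponential kept as a common factor, its own derivative in the next differentiation is
  -- multiplied by the other factor, which vanishes at `x` by `h1`.
  have hd : ∀ᶠ s in 𝓝 x, HasDerivAt (fun s ↦ q s * Real.exp (L * g s))
      ((q' s + L * q s * g' s) * Real.exp (L * g s)) s := by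
    filter_upwards [hq, hg] with s hqs hgs
    convert! hqs.mul (hgs.const_mul L).exp using 1
    ring
  have hd2 := ((hq'.add ((hq.self_of_nhds.const_mul L).mul hg')).mul
    (hg.self_of_nhds.const_mul L).exp)
  have h2 := second_deriv_nonpos_of_isLocalMax hd hd2 hmax
  have he := Real.exp_pos (L * g x)
  simp only [Pi.add_apply, Pi.mul_apply] at h2
  rw [h1, zero_mul, add_zero] at h2
  have h3 := nonpos_of_mul_nonpos_left h2 he
  have h4 : q' x = - (L * q x * g' x) := by linarith
  rw [h4] at h3
  nlinarith

variable {W : Type*} [NormedAddCommGroup W] [InnerProductSpace ℝ W]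

theorem hasDerivAt_two_inner {w w' : ℝ → W} {w'' : W} {x : ℝ}
    (hw : HasDerivAt w (w' x) x) (hw' : HasDerivAt w' w'' x) :
    HasDerivAt (fun s ↦ 2 * inner ℝ (w s) (w' s)) (2 * (inner ℝ (w x) w'' + ‖w' x‖ ^ 2)) x := by
  have := (hw.inner ℝ hw').const_mul 2
  rwa [real_inner_self_eq_norm_sq] at this

/-- Second order condition, along a curve, at a maximum of
`‖a - b‖² exp (L (‖a - p‖² + ‖b - p‖²))`. -/
theorem dist_weighted_max_second {a b p a' b' p' : ℝ → W} {a'' b'' p'' : W} {L x : ℝ}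
    (ha : ∀ᶠ s in 𝓝 x, HasDerivAt a (a' s) s) (hb : ∀ᶠ s in 𝓝 x, HasDerivAt b (b' s) s)
    (hp : ∀ᶠ s in 𝓝 x, HasDerivAt p (p' s) s)
    (ha' : HasDerivAt a' a'' x) (hb' : HasDerivAt b' b'' x) (hp' : HasDerivAt p' p'' x)
    (hmax : IsLocalMax (fun s ↦ ‖a s - b s‖ ^ 2 *
      Real.exp (L * (‖a s - p s‖ ^ 2 + ‖b s - p s‖ ^ 2))) x) :
    2 * (inner ℝ (a x - b x) (a'' - b'') + ‖a' x - b' x‖ ^ 2)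
      + L * ‖a x - b x‖ ^ 2 * (2 * (inner ℝ (a x - p x) (a'' - p'') + ‖a' x - p' x‖ ^ 2)
        + 2 * (inner ℝ (b x - p x) (b'' - p'') + ‖b' x - p' x‖ ^ 2))
      - L ^ 2 * ‖a x - b x‖ ^ 2 * (2 * inner ℝ (a x - p x) (a' x - p' x)
        + 2 * inner ℝ (b x - p x) (b' x - p' x)) ^ 2 ≤ 0 := by
  refine weighted_max_second (q' := fun s ↦ 2 * inner ℝ (a s - b s) (a' s - b' s))
    (g' := fun s ↦ 2 * inner ℝ (a s - p s) (a' s - p' s) + 2 * inner ℝ (b s - p s) (b' s - p' s))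
    ?_ ?_ ?_ ?_ hmax
  · filter_upwards [ha, hb] with s h1 h2 using (h1.sub h2).norm_sq
  · filter_upwards [ha, hb, hp] with s h1 h2 h3 using (h1.sub h3).norm_sq.add (h2.sub h3).norm_sq
  · exact hasDerivAt_two_inner (w := fun s ↦ a s - b s) (w' := fun s ↦ a' s - b' s)
      (ha.self_of_nhds.sub hb.self_of_nhds) (ha'.sub hb')
  · exact (hasDerivAt_two_inner (w := fun s ↦ a s - p s) (w' := fun s ↦ a' s - p' s)
      (ha.self_of_nhds.sub hp.self_of_nhds) (ha'.sub hp')).add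
      (hasDerivAt_two_inner (w := fun s ↦ b s - p s) (w' := fun s ↦ b' s - p' s)
      (hb.self_of_nhds.sub hp.self_of_nhds) (hb'.sub hp'))

theorem dist_weighted_max_first {a b p : ℝ → W} {a' b' p' : W} {L x : ℝ}
    (ha : HasDerivAt a a' x) (hb : HasDerivAt b b' x) (hp : HasDerivAt p p' x)
    (hmax : IsLocalMax (fun s ↦ ‖a s - b s‖ ^ 2 *
      Real.exp (L * (‖a s - p s‖ ^ 2 + ‖b s - p s‖ ^ 2))) x) :
    2 * inner ℝ (a x - b x) (a' - b') + L * ‖a x - b x‖ ^ 2 *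
      (2 * inner ℝ (a x - p x) (a' - p') + 2 * inner ℝ (b x - p x) (b' - p')) = 0 :=
  weighted_max_first (q := fun s ↦ ‖a s - b s‖ ^ 2)
    (g := fun s ↦ ‖a s - p s‖ ^ 2 + ‖b s - p s‖ ^ 2) (ha.sub hb).norm_sq
    ((ha.sub hp).norm_sq.add (hb.sub hp).norm_sq) hmax

/-- The reference point `p` does not move in time, so only `a` and `b` contribute derivatives. The
maximum is compared with earlier times only, which also covers a maximum at the final time. -/
theorem dist_weighted_max_time {a b : ℝ → W} {p a' b' : W} {L K t₀ t : ℝ} (ht : t₀ < t)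
    (ha : HasDerivAt a a' t) (hb : HasDerivAt b b' t)
    (hmax : ∀ s ∈ Icc t₀ t, ‖a s - b s‖ ^ 2 *
      Real.exp (L * (‖a s - p‖ ^ 2 + ‖b s - p‖ ^ 2) - K * s) ≤ ‖a t - b t‖ ^ 2 *
      Real.exp (L * (‖a t - p‖ ^ 2 + ‖b t - p‖ ^ 2) - K * t)) :
    K * ‖a t - b t‖ ^ 2 ≤ 2 * inner ℝ (a t - b t) (a' - b') + L * ‖a t - b t‖ ^ 2 *
      (2 * inner ℝ (a t - p) a' + 2 * inner ℝ (b t - p) b') := by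
  have hd := (ha.sub hb).norm_sq.mul (((((ha.sub_const p).norm_sq.add
    (hb.sub_const p).norm_sq).const_mul L).sub ((hasDerivAt_id t).const_mul K)).exp)
  have h := deriv_nonneg_of_max_left ht hd hmax
  set e := Real.exp (L * (‖a t - p‖ ^ 2 + ‖b t - p‖ ^ 2) - K * t) with he
  have hpos : 0 < e := Real.exp_pos _
  have h2 : 0 ≤ (2 * inner ℝ (a t - b t) (a' - b') + L * ‖a t - b t‖ ^ 2 *
      (2 * inner ℝ (a t - p) a' + 2 * inner ℝ (b t - p) b') - K * ‖a t - b t‖ ^ 2) * e := by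
    refine h.trans_eq ?_
    simp only [Pi.add_apply, Pi.sub_apply, id, ← he]
    ring
  linarith [nonneg_of_mul_nonneg_left h2 hpos]

end Calculus

/-! ### The algebraic heart: cancellation of gradients at a maximum. -/

section MaximumPoint

variable {W : Type*} [NormedAddCommGroup W] [InnerProductSpace ℝ W]

/-- Estimate of the second order terms in a single direction. -/
theorem direction_estimate {w f g α β χ A B P w2 f2 g2 : W} {C η L : ℝ} (hL : 0 ≤ L)
    (hf : ‖f‖ ≤ η) (hg : ‖g‖ ≤ η)
    (hA : ‖A‖ ≤ C * ‖α‖ ^ 2) (hB : ‖B‖ ≤ C * ‖β‖ ^ 2) (hP : ‖P‖ ≤ C * ‖χ‖ ^ 2)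
    (hAB : |inner ℝ w (A - B)| ≤ ‖α - β‖ ^ 2 + C * ‖w‖ ^ 2 * (‖α‖ ^ 2 + ‖β‖ ^ 2))
    (hCη : 2 * L * η * C ≤ 1) (hLη : 16 * L ^ 2 * η ^ 2 ≤ 1)
    (h2 : 2 * (inner ℝ w w2 + ‖α - β‖ ^ 2)
      + L * ‖w‖ ^ 2 * (2 * (inner ℝ f f2 + ‖α - χ‖ ^ 2) + 2 * (inner ℝ g g2 + ‖β - χ‖ ^ 2))
      - L ^ 2 * ‖w‖ ^ 2 * (2 * inner ℝ f (α - χ) + 2 * inner ℝ g (β - χ)) ^ 2 ≤ 0) :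
    2 * inner ℝ w (w2 - (A - B)) + L * ‖w‖ ^ 2 *
      (2 * inner ℝ f (f2 - (A - P)) + 2 * inner ℝ g (g2 - (B - P)))
      ≤ ‖w‖ ^ 2 * ((2 * C + 2 - L) * (‖α‖ ^ 2 + ‖β‖ ^ 2) + (4 + 4 * L) * ‖χ‖ ^ 2) := by
  have hη : 0 ≤ η := (norm_nonneg _).trans hf
  have key : ∀ h γ Q : W, ‖h‖ ≤ η → ‖Q‖ ≤ C * ‖γ‖ ^ 2 →
      - inner ℝ h (Q - P) ≤ η * C * (‖γ‖ ^ 2 + ‖χ‖ ^ 2) := by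
    intro h γ Q hh hQ
    calc - inner ℝ h (Q - P) ≤ |inner ℝ h (Q - P)| := neg_le_abs _
      _ ≤ ‖h‖ * ‖Q - P‖ := abs_real_inner_le_norm _ _
      _ ≤ η * (C * ‖γ‖ ^ 2 + C * ‖χ‖ ^ 2) :=
        mul_le_mul hh ((norm_sub_le _ _).trans (add_le_add hQ hP)) (norm_nonneg _) hη
      _ = _ := by ring
  -- In the form `‖γ - χ‖² ≥ ‖γ‖² / 2 - ‖χ‖²`, this is where the weight produces the negative
  -- multiple of `‖α‖² + ‖β‖²`.
  have half : ∀ γ : W, ‖γ‖ ^ 2 ≤ 2 * ‖γ - χ‖ ^ 2 + 2 * ‖χ‖ ^ 2 := by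
    intro γ
    have : ‖γ‖ ≤ ‖γ - χ‖ + ‖χ‖ := by simpa using norm_add_le (γ - χ) χ
    nlinarith [sq_nonneg (‖γ - χ‖ - ‖χ‖), norm_nonneg γ]
  have half' : ∀ γ : W, ‖γ - χ‖ ^ 2 ≤ 2 * ‖γ‖ ^ 2 + 2 * ‖χ‖ ^ 2 := by
    intro γ
    have : ‖γ - χ‖ ≤ ‖γ‖ + ‖χ‖ := norm_sub_le _ _
    nlinarith [sq_nonneg (‖γ‖ - ‖χ‖), norm_nonneg (γ - χ)]
  have kA := key f α A hf hA
  have kB := key g β B hg hB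
  have grad : (2 * inner ℝ f (α - χ) + 2 * inner ℝ g (β - χ)) ^ 2 ≤
      η ^ 2 * 16 * (‖α‖ ^ 2 + ‖β‖ ^ 2 + 2 * ‖χ‖ ^ 2) := by
    have c : ∀ h γ : W, ‖h‖ ≤ η → (inner ℝ h (γ - χ) : ℝ) ^ 2 ≤ η ^ 2 * ‖γ - χ‖ ^ 2 := by
      intro h γ hh
      rw [← mul_pow, sq_le_sq]
      refine (abs_real_inner_le_norm _ _).trans ?_
      rw [abs_of_nonneg (by positivity)]
      gcongr
    have c1 := c f α hf
    have c2 := c g β hg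
    have hs : (2 * inner ℝ f (α - χ) + 2 * inner ℝ g (β - χ)) ^ 2 ≤
        8 * ((inner ℝ f (α - χ) : ℝ) ^ 2 + (inner ℝ g (β - χ) : ℝ) ^ 2) := by
      nlinarith [sq_nonneg ((inner ℝ f (α - χ) : ℝ) - inner ℝ g (β - χ))]
    have := mul_le_mul_of_nonneg_left (add_le_add (half' α) (half' β)) (sq_nonneg η)
    nlinarith
  have grad' : L ^ 2 * (2 * inner ℝ f (α - χ) + 2 * inner ℝ g (β - χ)) ^ 2 ≤
      ‖α‖ ^ 2 + ‖β‖ ^ 2 + 2 * ‖χ‖ ^ 2 := by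
    refine (mul_le_mul_of_nonneg_left grad (sq_nonneg L)).trans ?_
    have := mul_le_mul_of_nonneg_right hLη
      (by positivity : 0 ≤ ‖α‖ ^ 2 + ‖β‖ ^ 2 + 2 * ‖χ‖ ^ 2)
    linarith
  have hess : L * (2 * -inner ℝ f (A - P) + 2 * -inner ℝ g (B - P)) ≤
      ‖α‖ ^ 2 + ‖β‖ ^ 2 + 2 * ‖χ‖ ^ 2 := by
    have h1 := mul_le_mul_of_nonneg_left (add_le_add kA kB) hL
    have h3 := mul_le_mul_of_nonneg_right hCη
      (by positivity : 0 ≤ ‖α‖ ^ 2 + ‖β‖ ^ 2 + 2 * ‖χ‖ ^ 2)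
    linarith
  have good : - (L * (2 * ‖α - χ‖ ^ 2 + 2 * ‖β - χ‖ ^ 2)) ≤
      L * (- (‖α‖ ^ 2 + ‖β‖ ^ 2) + 4 * ‖χ‖ ^ 2) := by
    have := mul_le_mul_of_nonneg_left (add_le_add (half α) (half β)) hL
    linarith
  have total := mul_le_mul_of_nonneg_left (add_le_add (add_le_add grad' hess) good)
    (sq_nonneg ‖w‖)
  -- Doubled, the term `‖α - β‖²` of this bound is exactly the one supplied by `h2`. The remaining
  -- coefficient of `‖α‖² + ‖β‖²` is `2 * C` from here, `1` from `grad'`, `1` from `hess` and `-L`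
  -- from `good`.
  have hAB' := neg_le_of_abs_le hAB
  rw [inner_sub_right w, inner_sub_right f f2, inner_sub_right g g2]
  linarith

/-- At a positive maximum of the weighted distance the growth rate `K` is bounded. -/
theorem growth_rate_le {κ : Type*} [Fintype κ] {w f g wt ft gt pt wb fb gb : W}
    {α β χ A B P w2 f2 g2 : κ → W}
    {C C' η L K : ℝ} (hC : 0 ≤ C) (hL : L = 2 * C + 2) (hw : w ≠ 0)
    (hf : ‖f‖ ≤ η) (hg : ‖g‖ ≤ η)
    (hA : ∀ i, ‖A i‖ ≤ C * ‖α i‖ ^ 2) (hB : ∀ i, ‖B i‖ ≤ C * ‖β i‖ ^ 2)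
    (hP : ∀ i, ‖P i‖ ≤ C * ‖χ i‖ ^ 2)
    (hAB : ∀ i, |inner ℝ w (A i - B i)| ≤
      ‖α i - β i‖ ^ 2 + C * ‖w‖ ^ 2 * (‖α i‖ ^ 2 + ‖β i‖ ^ 2))
    (hCη : 2 * L * η * C ≤ 1) (hLη : 16 * L ^ 2 * η ^ 2 ≤ 1)
    (h2 : ∀ i, 2 * (inner ℝ w (w2 i) + ‖α i - β i‖ ^ 2)
      + L * ‖w‖ ^ 2 * (2 * (inner ℝ f (f2 i) + ‖α i - χ i‖ ^ 2)
        + 2 * (inner ℝ g (g2 i) + ‖β i - χ i‖ ^ 2))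
      - L ^ 2 * ‖w‖ ^ 2 * (2 * inner ℝ f (α i - χ i) + 2 * inner ℝ g (β i - χ i)) ^ 2 ≤ 0)
    (h1 : 2 * inner ℝ w wb + L * ‖w‖ ^ 2 *
      (2 * inner ℝ f fb + 2 * inner ℝ g gb) = 0)
    (ht : K * ‖w‖ ^ 2 ≤ 2 * inner ℝ w wt + L * ‖w‖ ^ 2 * (2 * inner ℝ f ft + 2 * inner ℝ g gt))
    (ewt : wt = ∑ i, (w2 i - (A i - B i)) - wb)
    (eft : ft - pt = ∑ i, (f2 i - (A i - P i)) - fb)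
    (egt : gt - pt = ∑ i, (g2 i - (B i - P i)) - gb)
    (hχ : ∑ i, ‖χ i‖ ^ 2 ≤ C') (hpt : ‖pt‖ ≤ C') :
    K ≤ (4 + 4 * L) * C' + 4 * L * η * C' := by
  have hη : 0 ≤ η := (norm_nonneg _).trans hf
  have hL0 : 0 ≤ L := by linarith
  have hw0 : 0 < ‖w‖ ^ 2 := by positivity
  have hs := Finset.sum_le_sum fun i (_ : i ∈ Finset.univ) ↦
    direction_estimate hL0 hf hg (hA i) (hB i) (hP i) (hAB i) hCη hLη (h2 i)
  have e0 : 2 * C + 2 - L = 0 := by linarith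
  simp only [e0, zero_mul, zero_add] at hs
  rw [← Finset.mul_sum, ← Finset.mul_sum] at hs
  -- The drift terms `wb`, `fb`, `gb` enter in the combination that `h1` sets to zero. Subtracting
  -- `pt` supplies the second order terms of `p`; undoing it costs at most `4 * L * η * C'` per unit
  -- of `‖w‖ ^ 2`.
  have hs' : 2 * inner ℝ w (wt + wb) + L * ‖w‖ ^ 2 *
      (2 * inner ℝ f (ft - pt + fb) + 2 * inner ℝ g (gt - pt + gb)) ≤
      ‖w‖ ^ 2 * ((4 + 4 * L) * ∑ i, ‖χ i‖ ^ 2) := by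
    refine le_trans (le_of_eq ?_) hs
    rw [ewt, eft, egt, sub_add_cancel, sub_add_cancel, sub_add_cancel, inner_sum, inner_sum,
      inner_sum]
    simp only [Finset.mul_sum, ← Finset.sum_add_distrib]
  have hp : ∀ h : W, ‖h‖ ≤ η → inner ℝ h pt ≤ η * C' := fun h hh ↦
    (real_inner_le_norm _ _).trans (mul_le_mul hh hpt (norm_nonneg _) hη)
  have hpf := hp f hf
  have hpg := hp g hg
  have hb : L * ‖w‖ ^ 2 * (2 * inner ℝ f pt + 2 * inner ℝ g pt) ≤
      L * ‖w‖ ^ 2 * (4 * (η * C')) :=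
    mul_le_mul_of_nonneg_left (by linarith) (by positivity)
  have hχ' : ‖w‖ ^ 2 * ((4 + 4 * L) * ∑ i, ‖χ i‖ ^ 2) ≤ ‖w‖ ^ 2 * ((4 + 4 * L) * C') := by
    gcongr
  simp only [inner_add_right, inner_sub_right] at hs'
  refine le_of_mul_le_mul_right ?_ hw0
  nlinarith

end MaximumPoint

/-! ### Smoothness of differentials, Koszul expressions and inverse matrices. -/

section Smoothness

variable {F : Type*} [NormedAddCommGroup F] [NormedSpace ℝ F]
  {N : Type*} [TopologicalSpace N] [ChartedSpace F N] [IsManifold 𝓘(ℝ, F) ∞ N]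
  {W : Type*} [NormedAddCommGroup W] [NormedSpace ℝ W]

/-- The derivative of a smooth map to a vector space, as a function on the tangent bundle. -/
theorem contMDiff_mvfderiv_totalSpace {f : N → W} (hf : ContMDiff 𝓘(ℝ, F) 𝓘(ℝ, W) ∞ f) :
    ContMDiff 𝓘(ℝ, F).tangent 𝓘(ℝ, W) ∞
      (fun p : TangentBundle 𝓘(ℝ, F) N ↦ mvfderiv 𝓘(ℝ, F) f p.proj p.2) :=
  (contMDiff_snd_tangentBundle_modelSpace W 𝓘(ℝ, W)).comp
    (hf.contMDiff_tangentMap (m := ∞) le_rfl)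

theorem contMDiffOn_mvfderiv_apply {f : N → W} {X : ∀ x : N, TangentSpace 𝓘(ℝ, F) x} {U : Set N}
    (hU : IsOpen U) (hf : CMDiff[U] ∞ f) (hX : CMDiff[U] ∞ (T% X)) :
    CMDiff[U] ∞ (fun q ↦ mvfderiv 𝓘(ℝ, F) f q (X q)) := by
  have h1 := hf.contMDiffOn_tangentMapWithin (m := ∞) le_rfl hU.uniqueMDiffOn
  have h2 := (contMDiff_snd_tangentBundle_modelSpace (n := ∞) W 𝓘(ℝ, W)).comp_contMDiffOn
    (h1.comp hX fun q hq ↦ hq)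
  refine h2.congr fun q hq ↦ ?_
  simp only [Function.comp, tangentMapWithin, mfderivWithin_of_isOpen hU hq]
  rfl

theorem mdifferentiableAt_mvfderiv_apply {f : N → W} (hf : ContMDiff 𝓘(ℝ, F) 𝓘(ℝ, W) ∞ f)
    {X : ∀ x : N, TangentSpace 𝓘(ℝ, F) x} {y : N} (hX : MDiffAt (T% X) y) :
    MDiffAt (fun q ↦ mvfderiv 𝓘(ℝ, F) f q (X q)) y :=
  MDifferentiableAt.comp (I' := 𝓘(ℝ, F).tangent) y
    ((contMDiff_mvfderiv_totalSpace hf).mdifferentiable (by simp) _) hX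

end Smoothness

section Koszul

variable {F : Type*} [NormedAddCommGroup F] [NormedSpace ℝ F] [FiniteDimensional ℝ F]
  {N : Type*} [TopologicalSpace N] [ChartedSpace F N] [IsManifold 𝓘(ℝ, F) ∞ N]
  [RiemannianBundle (fun y : N ↦ TangentSpace 𝓘(ℝ, F) y)]
  [IsContMDiffRiemannianBundle 𝓘(ℝ, F) ∞ F (fun y : N ↦ TangentSpace 𝓘(ℝ, F) y)]

theorem contMDiffOn_inner {X Y : ∀ x : N, TangentSpace 𝓘(ℝ, F) x} {U : Set N}
    (hX : CMDiff[U] ∞ (T% X)) (hY : CMDiff[U] ∞ (T% Y)) :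
    CMDiff[U] ∞ (fun p ↦ inner ℝ (X p) (Y p)) :=
  ContMDiffOn.inner_bundle (F := F) (E := fun x : N ↦ TangentSpace 𝓘(ℝ, F) x)
    (b := fun x ↦ x) hX hY

theorem contMDiffOn_mlieBracket {X Y : ∀ x : N, TangentSpace 𝓘(ℝ, F) x} {U : Set N}
    (hU : IsOpen U) (hX : CMDiff[U] ∞ (T% X)) (hY : CMDiff[U] ∞ (T% Y)) :
    CMDiff[U] ∞ (T% (mlieBracket 𝓘(ℝ, F) X Y)) := fun x hx ↦ by
  have : IsManifold 𝓘(ℝ, F) (((⊤ : ℕ∞) : WithTop ℕ∞) + 1) N :=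
    inferInstanceAs (IsManifold 𝓘(ℝ, F) ∞ N)
  have : IsManifold 𝓘(ℝ, F) (minSmoothness ℝ 2) N := by
    rw [minSmoothness_of_isRCLikeNormedField]
    exact IsManifold.of_le (n := ∞) (by simpa using WithTop.coe_le_coe.2 (le_top : (2 : ℕ∞) ≤ ⊤))
  exact (ContMDiffAt.mlieBracket_vectorField (m := ⊤) (n := ⊤)
    (hX.contMDiffAt (hU.mem_nhds hx)) (hY.contMDiffAt (hU.mem_nhds hx)) (by simp)).contMDiffWithinAt

theorem contMDiffOn_koszul {X Y Z : ∀ x : N, TangentSpace 𝓘(ℝ, F) x} {U : Set N}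
    (hU : IsOpen U) (hX : CMDiff[U] ∞ (T% X)) (hY : CMDiff[U] ∞ (T% Y))
    (hZ : CMDiff[U] ∞ (T% Z)) : CMDiff[U] ∞ (koszul X Y Z) := by
  unfold koszul
  exact (((((contMDiffOn_mvfderiv_apply hU (contMDiffOn_inner hY hZ) hX).add
    (contMDiffOn_mvfderiv_apply hU (contMDiffOn_inner hX hZ) hY)).sub
    (contMDiffOn_mvfderiv_apply hU (contMDiffOn_inner hX hY) hZ)).add
    (contMDiffOn_inner (contMDiffOn_mlieBracket hU hX hY) hZ)).sub
    (contMDiffOn_inner (contMDiffOn_mlieBracket hU hX hZ) hY)).sub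
    (contMDiffOn_inner (contMDiffOn_mlieBracket hU hY hZ) hX)

end Koszul

section MatrixInverse

variable {F : Type*} [NormedAddCommGroup F] [NormedSpace ℝ F]
  {N : Type*} [TopologicalSpace N] [ChartedSpace F N]
  {κ : Type*} [Fintype κ] [DecidableEq κ]

theorem contMDiffOn_det {G : N → Matrix κ κ ℝ} {U : Set N}
    (hG : ∀ i j, CMDiff[U] ∞ (fun x ↦ G x i j)) :
    CMDiff[U] ∞ (fun x ↦ (G x).det) := by
  simp only [Matrix.det_apply']
  exact contMDiffOn_finsetSum fun σ _ ↦
    contMDiffOn_const.mul (contMDiffOn_finsetProd fun i _ ↦ hG _ _)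

/-- Cramer's rule: the inverse is the adjugate divided by the determinant, and both are polynomial
in the entries. -/
theorem contMDiffOn_matrix_inv {G : N → Matrix κ κ ℝ} {U : Set N}
    (hG : ∀ i j, CMDiff[U] ∞ (fun x ↦ G x i j)) (hdet : ∀ x ∈ U, (G x).det ≠ 0) (i j : κ) :
    CMDiff[U] ∞ (fun x ↦ (G x)⁻¹ i j) := by
  simp only [Matrix.inv_def, Ring.inverse_eq_inv', Matrix.smul_apply, smul_eq_mul,
    Matrix.adjugate_apply]
  refine ((contMDiffOn_det hG).inv₀ hdet).mul (contMDiffOn_det fun k l ↦ ?_)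
  by_cases h : k = j
  · subst h
    simpa using contMDiffOn_const
  · simpa [Matrix.updateRow_ne h] using hG k l

end MatrixInverse

/-! ### The Hessian of a vector-valued map, and its expression in a frame. -/

section Hessian

variable {F : Type*} [NormedAddCommGroup F] [NormedSpace ℝ F] [FiniteDimensional ℝ F]
  {N : Type*} [TopologicalSpace N] [ChartedSpace F N] [IsManifold 𝓘(ℝ, F) ∞ N]
  [RiemannianBundle (fun y : N ↦ TangentSpace 𝓘(ℝ, F) y)]
  [IsContMDiffRiemannianBundle 𝓘(ℝ, F) ∞ F (fun y : N ↦ TangentSpace 𝓘(ℝ, F) y)]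
  {W : Type*} [NormedAddCommGroup W] [NormedSpace ℝ W]

/-- The covariant derivative of a smooth vector field composed with the derivative of a smooth
map is smooth. -/
theorem contMDiffOn_mvfderiv_leviCivita {f : N → W} (hf : ContMDiff 𝓘(ℝ, F) 𝓘(ℝ, W) ∞ f)
    {κ : Type*} [Fintype κ] {Z : κ → ∀ x : N, TangentSpace 𝓘(ℝ, F) x} {U : Set N} (hU : IsOpen U)
    (hZ : IsLocalFrameOn 𝓘(ℝ, F) F ∞ Z U)
    {X Y : ∀ x : N, TangentSpace 𝓘(ℝ, F) x} (hX : CMDiff[U] ∞ (T% X)) (hY : CMDiff[U] ∞ (T% Y)) :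
    CMDiff[U] ∞ (fun q ↦ mvfderiv 𝓘(ℝ, F) f q (leviCivita Y q (X q))) := by
  classical
  let G : N → Matrix κ κ ℝ := fun q ↦ Matrix.gram ℝ (fun i ↦ Z i q)
  have hG : ∀ i j, CMDiff[U] ∞ (fun q ↦ G q i j) := fun i j ↦
    contMDiffOn_inner (hZ.contMDiffOn i) (hZ.contMDiffOn j)
  have hdet : ∀ q ∈ U, (G q).det ≠ 0 := fun q hq ↦
    (Matrix.posDef_gram_of_linearIndependent (hZ.linearIndependent hq)).det_pos.ne'
  have key : ∀ q ∈ U, mvfderiv 𝓘(ℝ, F) f q (leviCivita Y q (X q)) =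
      ∑ i, (∑ j, koszul X Y (Z j) q / 2 * (G q)⁻¹ j i) • mvfderiv 𝓘(ℝ, F) f q (Z i q) := by
    intro q hq
    have hm : ∀ {V : ∀ x : N, TangentSpace 𝓘(ℝ, F) x}, CMDiff[U] ∞ (T% V) → MDiffAt (T% V) q :=
      fun hV ↦ (hV.contMDiffAt (hU.mem_nhds hq)).mdifferentiableAt (by simp)
    set w := leviCivita Y q (X q) with hw
    obtain ⟨c, hc⟩ : ∃ c : κ → ℝ, w = ∑ i, c i • Z i q :=
      ⟨(hZ.toBasisAt hq).repr w, by simpa using ((hZ.toBasisAt hq).sum_repr w).symm⟩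
    -- The Koszul formula only gives inner products with the frame; the coefficients of the
    -- covariant derivative come from inverting the Gram matrix.
    have hk : (fun j ↦ koszul X Y (Z j) q / 2) = Matrix.vecMul c (G q) := by
      ext j
      rw [← inner_leviCivitaFun (hm hX) (hm hY) (hm (hZ.contMDiffOn j))]
      change inner ℝ w (Z j q) = _
      rw [hc, sum_inner]
      simp [Matrix.vecMul, dotProduct, G, Matrix.gram, inner_smul_left]
    have hc' : Matrix.vecMul (fun j ↦ koszul X Y (Z j) q / 2) (G q)⁻¹ = c := by
      rw [hk, Matrix.vecMul_vecMul, Matrix.mul_nonsing_inv _ (hdet q hq).isUnit, Matrix.vecMul_one]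
    rw [hc, map_sum]
    refine Finset.sum_congr rfl fun i _ ↦ ?_
    rw [map_smul]
    congr 1
    exact (congrFun hc' i).symm
  refine ContMDiffOn.congr (contMDiffOn_finsetSum fun i _ ↦ ?_) key
  have hcoef : CMDiff[U] ∞ (fun q ↦ ∑ j, koszul X Y (Z j) q / 2 * (G q)⁻¹ j i) := by
    simp only [div_eq_mul_inv]
    exact contMDiffOn_finsetSum fun j _ ↦
      ((contMDiffOn_koszul hU hX hY (hZ.contMDiffOn j)).mul contMDiffOn_const).mul
        (contMDiffOn_matrix_inv hG hdet j i)
  exact hcoef.smul (contMDiffOn_mvfderiv_apply hU hf.contMDiffOn (hZ.contMDiffOn i))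

/-- The Hessian of a vector-valued map, with the second argument extended to a vector field. -/
noncomputable def hessField (f : N → W) (y : N) (b : TangentSpace 𝓘(ℝ, F) y)
    (X : ∀ x : N, TangentSpace 𝓘(ℝ, F) x) : W :=
  mvfderiv 𝓘(ℝ, F) (fun q ↦ mvfderiv 𝓘(ℝ, F) f q (X q)) y b
    - mvfderiv 𝓘(ℝ, F) f y (leviCivita X y b)

/-- The Hessian of a vector-valued map. -/
noncomputable def hess (f : N → W) (y : N) (a b : TangentSpace 𝓘(ℝ, F) y) : W :=
  hessField f y b (FiberBundle.extend F a)

/-- The derivatives of the coefficient produced by the two Leibniz rules cancel, so the Hessian does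
not depend on the extension of its argument. -/
theorem hessField_tensorial {f : N → W} (hf : ContMDiff 𝓘(ℝ, F) 𝓘(ℝ, W) ∞ f) (y : N)
    (b : TangentSpace 𝓘(ℝ, F) y) : TensorialAt 𝓘(ℝ, F) F (hessField f y b) y where
  smul {g X} hg hX := by
    have h1 := leviCivita (M := N) |>.isCovariantDerivativeOnUniv.leibniz hX hg
    have e : (fun q ↦ mvfderiv 𝓘(ℝ, F) f q ((g • X) q)) =
        g • (fun q ↦ mvfderiv 𝓘(ℝ, F) f q (X q)) := by
      ext q; simp
    have h2 := mvfderiv_smul hg (mdifferentiableAt_mvfderiv_apply hf hX)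
    simp only [hessField, e, h2]
    erw [h1]
    simp
    module
  add {X X'} hX hX' := by
    have h1 := leviCivita (M := N) |>.isCovariantDerivativeOnUniv.add hX hX'
    have e : (fun q ↦ mvfderiv 𝓘(ℝ, F) f q ((X + X') q)) =
        (fun q ↦ mvfderiv 𝓘(ℝ, F) f q (X q)) + (fun q ↦ mvfderiv 𝓘(ℝ, F) f q (X' q)) := by
      ext q; simp
    have h2 := mvfderiv_add (mdifferentiableAt_mvfderiv_apply hf hX)
      (mdifferentiableAt_mvfderiv_apply hf hX')
    simp only [hessField, e, h2]
    erw [h1]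
    simp
    module

/-- The Hessian in terms of a local frame. -/
theorem hess_sum_frame {f : N → W} (hf : ContMDiff 𝓘(ℝ, F) 𝓘(ℝ, W) ∞ f)
    {κ : Type*} [Fintype κ] {Z : κ → ∀ x : N, TangentSpace 𝓘(ℝ, F) x} {y : N}
    (hZ : ∀ i, MDiffAt (T% (Z i)) y) (c d : κ → ℝ) :
    hess f y (∑ i, c i • Z i y) (∑ j, d j • Z j y) =
      ∑ i, ∑ j, (c i * d j) • hessField f y (Z j y) (Z i) := by
  have hb : ∀ X : ∀ x : N, TangentSpace 𝓘(ℝ, F) x,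
      hessField f y (∑ j, d j • Z j y) X = ∑ j, d j • hessField f y (Z j y) X := by
    intro X
    simp [hessField, map_sum, smul_sub, Finset.sum_sub_distrib]
  have hc : ∀ i, MDiffAt (T% (fun x ↦ c i • Z i x)) y := fun i ↦
    (mdifferentiableAt_const (c := c i)).smul_section (hZ i)
  have ht := hessField_tensorial hf y (∑ j, d j • Z j y)
  have h1 : hess f y (∑ i, c i • Z i y) (∑ j, d j • Z j y) =
      hessField f y (∑ j, d j • Z j y) (fun x ↦ ∑ i, c i • Z i x) :=
    ht.pointwise (FiberBundle.mdifferentiableAt_extend 𝓘(ℝ, F) F _)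
      (MDifferentiableAt.sum_section fun i _ ↦ hc i) (by simp)
  rw [h1, ht.sum _ fun i _ ↦ hc i]
  refine Finset.sum_congr rfl fun i _ ↦ ?_
  have h2 := ht.smul (f := fun _ ↦ c i) mdifferentiableAt_const (hZ i)
  refine h2.trans ?_
  rw [hb, Finset.smul_sum]
  exact Finset.sum_congr rfl fun j _ ↦ by rw [smul_smul]

end Hessian

/-- Local bounds with monotone constants are uniform on a compact space. -/
theorem exists_uniform_bound {X : Type*} [TopologicalSpace X] [CompactSpace X] {P : X → ℝ → Prop}
    (hP : ∀ x C C', C ≤ C' → P x C → P x C') (hloc : ∀ x, ∃ C, ∀ᶠ y in 𝓝 x, P y C) :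
    ∃ C, 0 ≤ C ∧ ∀ x, P x C := by
  have h : ∃ C, 0 ≤ C ∧ ∀ x ∈ (univ : Set X), P x C := by
    refine isCompact_univ.induction_on (p := fun s ↦ ∃ C, 0 ≤ C ∧ ∀ x ∈ s, P x C)
      ⟨0, le_rfl, by simp⟩ ?_ ?_ ?_
    · rintro s t hst ⟨C, hC, h⟩
      exact ⟨C, hC, fun x hx ↦ h x (hst hx)⟩
    · rintro s t ⟨C, hC, h⟩ ⟨C', hC', h'⟩
      refine ⟨max C C', hC.trans (le_max_left _ _), ?_⟩
      rintro x (hx | hx)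
      · exact hP x _ _ (le_max_left _ _) (h x hx)
      · exact hP x _ _ (le_max_right _ _) (h' x hx)
    · intro x _
      obtain ⟨C, hC⟩ := hloc x
      exact ⟨_, mem_nhdsWithin_of_mem_nhds hC, max C 0, le_max_right _ _,
        fun y hy ↦ hP y _ _ (le_max_left _ _) hy⟩
  simpa using h

/-! ### Linear algebra of nearby frames. -/

section FrameAlgebra

variable {κ : Type*} [Fintype κ] {W : Type*} [NormedAddCommGroup W] [NormedSpace ℝ W]

theorem norm_sum_smul_le (c : κ → ℝ) {E : κ → W} {B : ℝ} (hE : ∀ i, ‖E i‖ ≤ B) :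
    ‖∑ i, c i • E i‖ ≤ Fintype.card κ * B * ‖c‖ := by
  refine (norm_sum_le _ _).trans ?_
  calc ∑ i, ‖c i • E i‖ ≤ ∑ _i : κ, ‖c‖ * B := Finset.sum_le_sum fun i _ ↦ by
        rw [norm_smul]
        exact mul_le_mul (norm_le_pi_norm c i) (hE i) (norm_nonneg _) (norm_nonneg _)
    _ = _ := by simp; ring

/-- Linear independence is stable, with bounds. -/
theorem exists_norm_le_sum_smul {E : κ → W} (hE : LinearIndependent ℝ E) :
    ∃ K > 0, ∃ ε > 0, ∀ E' : κ → W, (∀ i, ‖E' i - E i‖ ≤ ε) →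
      ∀ c : κ → ℝ, ‖c‖ ≤ K * ‖∑ i, c i • E' i‖ := by
  obtain ⟨K, hK, hanti⟩ := (Fintype.linearCombination ℝ E).exists_antilipschitzWith
    (LinearMap.ker_eq_bot.2 hE.fintypeLinearCombination_injective)
  have hK' : (0 : ℝ) < K := hK
  set n : ℝ := (Fintype.card κ : ℝ)
  have hn : 0 ≤ n := Nat.cast_nonneg _
  -- With this `ε` the perturbation of the frame costs at most `‖c‖ / 2`, which is absorbed by
  -- doubling `K`.
  refine ⟨2 * K, by positivity, 1 / (2 * K * (n + 1)), by positivity, fun E' hE' c ↦ ?_⟩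
  have h1 : ‖c‖ ≤ K * ‖∑ i, c i • E i‖ := by
    have := hanti.le_mul_norm (map_zero (Fintype.linearCombination ℝ E)) c
    simpa [Fintype.linearCombination_apply] using this
  have h2 : ‖∑ i, c i • E i‖ ≤ ‖∑ i, c i • E' i‖ + n * (1 / (2 * K * (n + 1))) * ‖c‖ := by
    have : ∑ i, c i • E i = ∑ i, c i • E' i - ∑ i, c i • (E' i - E i) := by
      rw [← Finset.sum_sub_distrib]
      exact Finset.sum_congr rfl fun i _ ↦ by module
    rw [this]
    exact (norm_sub_le _ _).trans (by gcongr; exact norm_sum_smul_le c hE')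
  have h3 : K * (n * (1 / (2 * K * (n + 1))) * ‖c‖) ≤ ‖c‖ / 2 := by
    have : K * (n * (1 / (2 * K * (n + 1)))) ≤ 1 / 2 := by
      rw [mul_one_div, mul_div_assoc', div_le_iff₀ (by positivity)]
      nlinarith
    nlinarith [norm_nonneg c]
  nlinarith [mul_le_mul_of_nonneg_left h2 hK'.le]

theorem norm_sum_sum_smul_le {m : κ → κ → ℝ} {S : κ → κ → W} {A B : ℝ} (hA : 0 ≤ A)
    (hm : ∀ i j, |m i j| ≤ A) (hS : ∀ i j, ‖S i j‖ ≤ B) :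
    ‖∑ i, ∑ j, m i j • S i j‖ ≤ (Fintype.card κ) ^ 2 * (A * B) := by
  refine (norm_sum_le _ _).trans ?_
  calc ∑ i, ‖∑ j, m i j • S i j‖ ≤ ∑ _i : κ, ∑ _j : κ, A * B := Finset.sum_le_sum fun i _ ↦
        (norm_sum_le _ _).trans (Finset.sum_le_sum fun j _ ↦ by
          rw [norm_smul]
          exact mul_le_mul (hm i j) (hS i j) (norm_nonneg _) hA)
    _ = _ := by simp; ring

/-- Difference of two quadratic forms, each given in its own frame. -/
theorem quadratic_frame_estimate {E E' : κ → W} {S S' : κ → κ → W} {K B C δ : ℝ}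
    (hK : 0 ≤ K) (hB : 0 ≤ B) (hC : 0 ≤ C) (hδ : 0 ≤ δ)
    (hE : ∀ c : κ → ℝ, ‖c‖ ≤ K * ‖∑ i, c i • E i‖)
    (hE' : ∀ c : κ → ℝ, ‖c‖ ≤ K * ‖∑ i, c i • E' i‖)
    (hEE : ∀ i, ‖E i - E' i‖ ≤ C * δ) (hS : ∀ i j, ‖S i j‖ ≤ B)
    (hSS : ∀ i j, ‖S i j - S' i j‖ ≤ C * δ) (c d : κ → ℝ) :
    let n : ℝ := Fintype.card κ
    let α := ∑ i, c i • E i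
    let β := ∑ i, d i • E' i
    ‖∑ i, ∑ j, (c i * c j) • S i j - ∑ i, ∑ j, (d i * d j) • S' i j‖ ≤
      (n ^ 2 * B * K ^ 2 * (1 + n * C * K) + n ^ 2 * K ^ 2 * C) *
        (‖α - β‖ + δ * (‖α‖ + ‖β‖)) * (‖α‖ + ‖β‖) := by
  intro n α β
  have hn : 0 ≤ n := Nat.cast_nonneg _
  have h1 : ‖c‖ ≤ K * ‖α‖ := hE c
  have h2 : ‖d‖ ≤ K * ‖β‖ := hE' d
  have h3 : ‖c - d‖ ≤ K * (‖α - β‖ + n * (C * δ) * ‖d‖) := by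
    refine (hE (c - d)).trans (mul_le_mul_of_nonneg_left ?_ hK)
    -- The two vectors are given in different frames; rewriting `β` in the frame `E` leaves an error
    -- of order `δ * ‖d‖`.
    have : ∑ i, (c - d) i • E i = (α - β) - ∑ i, d i • (E i - E' i) := by
      simp only [α, β, ← Finset.sum_sub_distrib]
      exact Finset.sum_congr rfl fun i _ ↦ by simp only [Pi.sub_apply]; module
    rw [this]
    exact (norm_sub_le _ _).trans (by gcongr; exact norm_sum_smul_le d hEE)
  have hsplit : ∑ i, ∑ j, (c i * c j) • S i j - ∑ i, ∑ j, (d i * d j) • S' i j =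
      ∑ i, ∑ j, (c i * c j - d i * d j) • S i j + ∑ i, ∑ j, (d i * d j) • (S i j - S' i j) := by
    simp only [← Finset.sum_sub_distrib, ← Finset.sum_add_distrib]
    exact Finset.sum_congr rfl fun i _ ↦ Finset.sum_congr rfl fun j _ ↦ by module
  have hcd : ∀ i j, |c i * c j - d i * d j| ≤ ‖c - d‖ * (‖c‖ + ‖d‖) := by
    intro i j
    have e : c i * c j - d i * d j = (c i - d i) * c j + d i * (c j - d j) := by ring
    have b1 := norm_le_pi_norm (c - d) i
    have b2 := norm_le_pi_norm (c - d) j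
    have b3 := norm_le_pi_norm c j
    have b4 := norm_le_pi_norm d i
    simp only [Pi.sub_apply, Real.norm_eq_abs] at b1 b2 b3 b4
    rw [e]
    refine (abs_add_le _ _).trans ?_
    rw [abs_mul, abs_mul]
    have := mul_le_mul b1 b3 (abs_nonneg _) (norm_nonneg _)
    have := mul_le_mul b4 b2 (abs_nonneg _) (norm_nonneg _)
    linarith
  have hdd : ∀ i j, |d i * d j| ≤ ‖d‖ ^ 2 := by
    intro i j
    rw [abs_mul, sq]
    exact mul_le_mul (norm_le_pi_norm d i) (norm_le_pi_norm d j) (abs_nonneg _) (norm_nonneg _)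
  have e1 := norm_sum_sum_smul_le (by positivity) hcd hS
  have e2 := norm_sum_sum_smul_le (by positivity) hdd hSS
  rw [hsplit]
  refine (norm_add_le _ _).trans ((add_le_add e1 e2).trans ?_)
  set s := ‖α‖ + ‖β‖ with hs
  have hs0 : 0 ≤ s := by positivity
  have hds : ‖d‖ ≤ K * s := h2.trans (by gcongr; simp [hs])
  have hcds : ‖c‖ + ‖d‖ ≤ K * s := by rw [hs, mul_add]; gcongr
  have h4 : ‖c - d‖ ≤ K * (1 + n * C * K) * (‖α - β‖ + δ * s) := by
    refine h3.trans ?_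
    rw [mul_assoc K]
    refine mul_le_mul_of_nonneg_left ?_ hK
    have : n * (C * δ) * ‖d‖ ≤ n * (C * δ) * (K * s) := by gcongr
    have h5 : 0 ≤ n * C * K * ‖α - β‖ := by positivity
    have h6 : 0 ≤ δ * s := by positivity
    nlinarith
  have h7 : ‖c - d‖ * (‖c‖ + ‖d‖) ≤ K * (1 + n * C * K) * (‖α - β‖ + δ * s) * (K * s) := by
    gcongr
  have h8 : ‖d‖ ^ 2 ≤ (K * s) ^ 2 := by gcongr
  have h9 : (K * s) ^ 2 * (C * δ) ≤ K ^ 2 * C * (‖α - β‖ + δ * s) * s := by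
    have : 0 ≤ K ^ 2 * C * ‖α - β‖ * s := by positivity
    nlinarith
  calc n ^ 2 * (‖c - d‖ * (‖c‖ + ‖d‖) * B) + n ^ 2 * (‖d‖ ^ 2 * (C * δ))
      ≤ n ^ 2 * (K * (1 + n * C * K) * (‖α - β‖ + δ * s) * (K * s) * B)
        + n ^ 2 * (K ^ 2 * C * (‖α - β‖ + δ * s) * s) := by
        refine add_le_add (by gcongr) (mul_le_mul_of_nonneg_left ?_ (sq_nonneg n))
        exact (mul_le_mul_of_nonneg_right h8 (by positivity)).trans h9
    _ = _ := by ring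

end FrameAlgebra

/-! ### Measuring distances on the manifold through an immersion. -/

section Immersion

variable {F : Type*} [NormedAddCommGroup F] [NormedSpace ℝ F] [FiniteDimensional ℝ F]
  {N : Type*} [TopologicalSpace N] [ChartedSpace F N] [IsManifold 𝓘(ℝ, F) ∞ N]
  {W : Type*} [NormedAddCommGroup W] [NormedSpace ℝ W]
  {V : Type*} [NormedAddCommGroup V] [NormedSpace ℝ V]

/-- An injective linear map in finite dimension is bounded below, and strict differentiability makes
the error uniform over pairs of points, small enough to absorb half of that lower bound. -/
theorem exists_local_antilipschitz {f : F → W} {f' : F →L[ℝ] W} {x : F}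
    (hf : HasStrictFDerivAt f f' x) (hinj : Function.Injective f') :
    ∃ C > 0, ∀ᶠ p in 𝓝 (x, x), ‖p.1 - p.2‖ ≤ C * ‖f p.1 - f p.2‖ := by
  obtain ⟨K, hK, hanti⟩ := (f' : F →ₗ[ℝ] W).exists_antilipschitzWith (LinearMap.ker_eq_bot.2 hinj)
  have hK' : (0 : ℝ) < K := hK
  refine ⟨2 * K, by positivity, ?_⟩
  filter_upwards [hf.isLittleO.def (c := 1 / (2 * K)) (by positivity)] with p hp
  have h1 : ‖p.1 - p.2‖ ≤ K * ‖f' (p.1 - p.2)‖ := hanti.le_mul_norm (map_zero _) (p.1 - p.2)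
  have h2 : ‖f' (p.1 - p.2)‖ ≤ ‖f p.1 - f p.2‖ + 1 / (2 * K) * ‖p.1 - p.2‖ := by
    have : f' (p.1 - p.2) = (f p.1 - f p.2) - (f p.1 - f p.2 - f' (p.1 - p.2)) := by abel
    rw [this]
    exact (norm_sub_le _ _).trans (by gcongr)
  have h3 : K * (1 / (2 * K) * ‖p.1 - p.2‖) = ‖p.1 - p.2‖ / 2 := by field_simp
  nlinarith [mul_le_mul_of_nonneg_left h2 hK'.le]

theorem hasStrictFDerivAt_comp_extChartAt_symm {f : N → W} {y : N}
    (hf : ContMDiffAt 𝓘(ℝ, F) 𝓘(ℝ, W) ∞ f y) :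
    HasStrictFDerivAt (f ∘ (extChartAt 𝓘(ℝ, F) y).symm) (mvfderiv 𝓘(ℝ, F) f y)
      (extChartAt 𝓘(ℝ, F) y y) := by
  have h1 := (contMDiffAt_iff.1 hf).2
  simp only [mfld_simps, contDiffWithinAt_univ] at h1
  have h2 := h1.hasStrictFDerivAt (by simp)
  have h3 := (hf.mdifferentiableAt (by simp)).mvfderiv
  simp only [mfld_simps, fderivWithin_univ] at h3
  rw [h3]
  exact h2

/-- A smooth map is locally Lipschitz with respect to an immersion. -/
theorem exists_local_lipschitz_immersion {f : N → W} {y : N}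
    (hf : ContMDiffAt 𝓘(ℝ, F) 𝓘(ℝ, W) ∞ f y)
    (hinj : Function.Injective (mvfderiv 𝓘(ℝ, F) f y)) {g : N → V}
    (hg : ContMDiffAt 𝓘(ℝ, F) 𝓘(ℝ, V) ∞ g y) :
    ∃ C ≥ 0, ∀ᶠ p in 𝓝 (y, y), ‖g p.1 - g p.2‖ ≤ C * ‖f p.1 - f p.2‖ := by
  obtain ⟨C, hC, h1⟩ := exists_local_antilipschitz (hasStrictFDerivAt_comp_extChartAt_symm hf) hinj
  obtain ⟨C', hC', h2⟩ := (hasStrictFDerivAt_comp_extChartAt_symm hg).isBigO_sub.exists_nonneg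
  refine ⟨C' * C, by positivity, ?_⟩
  have hψ := (continuousAt_extChartAt (I := 𝓘(ℝ, F)) y)
  have ht : Filter.Tendsto (fun p : N × N ↦ (extChartAt 𝓘(ℝ, F) y p.1, extChartAt 𝓘(ℝ, F) y p.2))
      (𝓝 (y, y)) (𝓝 (extChartAt 𝓘(ℝ, F) y y, extChartAt 𝓘(ℝ, F) y y)) := by
    rw [nhds_prod_eq, nhds_prod_eq]
    exact hψ.tendsto.prodMap hψ.tendsto
  have hs := extChartAt_source_mem_nhds (I := 𝓘(ℝ, F)) y
  filter_upwards [ht.eventually h1, ht.eventually h2.bound,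
    (nhds_prod_eq (x := y) (y := y)) ▸ Filter.prod_mem_prod hs hs] with p hp1 hp2 hp3
  simp only [Function.comp, (extChartAt 𝓘(ℝ, F) y).left_inv hp3.1,
    (extChartAt 𝓘(ℝ, F) y).left_inv hp3.2] at hp1 hp2
  refine hp2.trans ?_
  rw [mul_assoc]
  gcongr

end Immersion

/-! ### Uniform estimates for the Hessian of an embedding. -/

section HessianBounds

variable {F : Type*} [NormedAddCommGroup F] [NormedSpace ℝ F] [FiniteDimensional ℝ F]
  {N : Type*} [TopologicalSpace N] [ChartedSpace F N] [IsManifold 𝓘(ℝ, F) ∞ N]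
  [RiemannianBundle (fun y : N ↦ TangentSpace 𝓘(ℝ, F) y)]
  [IsContMDiffRiemannianBundle 𝓘(ℝ, F) ∞ F (fun y : N ↦ TangentSpace 𝓘(ℝ, F) y)]
  {W : Type*} [NormedAddCommGroup W] [NormedSpace ℝ W]

/-- Near a point, the Hessian of an immersion depends in a Lipschitz way on the point and the
vector, both measured through the immersion. -/
theorem exists_local_hess_sub_le {f : N → W} (hf : ContMDiff 𝓘(ℝ, F) 𝓘(ℝ, W) ∞ f)
    (hinj : ∀ y, Function.Injective (mvfderiv 𝓘(ℝ, F) f y)) (y₀ : N) :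
    ∃ C : ℝ, ∀ᶠ p in 𝓝 (y₀, y₀), ∀ (a : TangentSpace 𝓘(ℝ, F) p.1) (b : TangentSpace 𝓘(ℝ, F) p.2),
      ‖hess f p.1 a a - hess f p.2 b b‖ ≤
        C * (‖mvfderiv 𝓘(ℝ, F) f p.1 a - mvfderiv 𝓘(ℝ, F) f p.2 b‖ + ‖f p.1 - f p.2‖ *
          (‖mvfderiv 𝓘(ℝ, F) f p.1 a‖ + ‖mvfderiv 𝓘(ℝ, F) f p.2 b‖)) *
          (‖mvfderiv 𝓘(ℝ, F) f p.1 a‖ + ‖mvfderiv 𝓘(ℝ, F) f p.2 b‖) := by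
  set e := trivializationAt F (fun y : N ↦ TangentSpace 𝓘(ℝ, F) y) y₀
  set κ := Fin (Module.finrank ℝ F)
  let Z : κ → ∀ x : N, TangentSpace 𝓘(ℝ, F) x := e.localFrame (Module.finBasis ℝ F)
  set U := e.baseSet
  have hU : IsOpen U := e.open_baseSet
  have hy₀ : y₀ ∈ U := FiberBundle.mem_baseSet_trivializationAt' y₀
  have hZ : IsLocalFrameOn 𝓘(ℝ, F) F ∞ Z U := e.isLocalFrameOn_localFrame_baseSet _ _ _
  have hZ1 : ∀ y ∈ U, ∀ i, MDiffAt (T% (Z i)) y := fun y hy i ↦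
    ((hZ.contMDiffOn i).contMDiffAt (hU.mem_nhds hy)).mdifferentiableAt (by simp)
  let E : N → κ → W := fun q i ↦ mvfderiv 𝓘(ℝ, F) f q (Z i q)
  let S : N → κ → κ → W := fun q i j ↦ hessField f q (Z j q) (Z i)
  have hE : ∀ i, CMDiff[U] ∞ (fun q ↦ E q i) := fun i ↦
    contMDiffOn_mvfderiv_apply hU hf.contMDiffOn (hZ.contMDiffOn i)
  have hS : ∀ i j, CMDiff[U] ∞ (fun q ↦ S q i j) := fun i j ↦
    (contMDiffOn_mvfderiv_apply hU (hE i) (hZ.contMDiffOn j)).sub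
      (contMDiffOn_mvfderiv_leviCivita hf hU hZ (hZ.contMDiffOn j) (hZ.contMDiffOn i))
  have hE0 := fun i ↦ (hE i).contMDiffAt (hU.mem_nhds hy₀)
  have hS0 := fun i j ↦ (hS i j).contMDiffAt (hU.mem_nhds hy₀)
  -- An immersion carries the frame to independent vectors of `W`, so coefficients of tangent
  -- vectors near `y₀` are controlled by the images of those vectors.
  have hli : LinearIndependent ℝ (E y₀) :=
    (hZ.linearIndependent hy₀).map' (mvfderiv 𝓘(ℝ, F) f y₀).toLinearMap
      (LinearMap.ker_eq_bot.2 (hinj y₀))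
  obtain ⟨K, hK, ε, hε, hKE⟩ := exists_norm_le_sum_smul hli
  have hEnear : ∀ᶠ q in 𝓝 y₀, ∀ i, ‖E q i - E y₀ i‖ ≤ ε := by
    refine Filter.eventually_all.2 fun i ↦ ?_
    filter_upwards [(hE0 i).continuousAt (Metric.closedBall_mem_nhds _ hε)] with q hq
    simpa [dist_eq_norm] using hq
  have hSnear : ∃ B ≥ 0, ∀ᶠ q in 𝓝 y₀, ∀ i j, ‖S q i j‖ ≤ B := by
    refine ⟨∑ i, ∑ j, ‖S y₀ i j‖ + 1, by positivity, ?_⟩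
    refine Filter.eventually_all.2 fun i ↦ Filter.eventually_all.2 fun j ↦ ?_
    have h1 : ‖S y₀ i j‖ < ∑ i, ∑ j, ‖S y₀ i j‖ + 1 := by
      have h2 := Finset.single_le_sum (f := fun j ↦ ‖S y₀ i j‖) (fun _ _ ↦ norm_nonneg _)
        (Finset.mem_univ j)
      have h3 := Finset.single_le_sum (f := fun i ↦ ∑ j, ‖S y₀ i j‖)
        (fun _ _ ↦ Finset.sum_nonneg fun _ _ ↦ norm_nonneg _) (Finset.mem_univ i)
      linarith
    exact ((hS0 i j).continuousAt.norm.eventually_lt_const h1).mono fun _ h ↦ h.le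
  obtain ⟨B, hB, hSnear⟩ := hSnear
  choose CE hCE0 hCE using fun i ↦ exists_local_lipschitz_immersion hf.contMDiffAt (hinj y₀) (hE0 i)
  choose CS hCS0 hCS using fun i j ↦
    exists_local_lipschitz_immersion hf.contMDiffAt (hinj y₀) (hS0 i j)
  set C := ∑ i, CE i + ∑ i, ∑ j, CS i j
  have hCEC : ∀ i, CE i ≤ C := fun i ↦ by
    have h2 := Finset.single_le_sum (fun i _ ↦ hCE0 i) (Finset.mem_univ i)
    have h3 : 0 ≤ ∑ i, ∑ j, CS i j := Finset.sum_nonneg fun i _ ↦ Finset.sum_nonneg fun j _ ↦ hCS0 i j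
    linarith
  have hCSC : ∀ i j, CS i j ≤ C := fun i j ↦ by
    have h1 : 0 ≤ ∑ i, CE i := Finset.sum_nonneg fun i _ ↦ hCE0 i
    have h2 := Finset.single_le_sum (fun j _ ↦ hCS0 i j) (Finset.mem_univ j)
    have h3 := Finset.single_le_sum (f := fun i ↦ ∑ j, CS i j)
      (fun i _ ↦ Finset.sum_nonneg fun j _ ↦ hCS0 i j) (Finset.mem_univ i)
    linarith
  have hC : 0 ≤ C := add_nonneg (Finset.sum_nonneg fun i _ ↦ hCE0 i)
    (Finset.sum_nonneg fun i _ ↦ Finset.sum_nonneg fun j _ ↦ hCS0 i j)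
  have hprod := ((hU.eventually_mem hy₀).and (hEnear.and hSnear))
  refine ⟨(Fintype.card κ : ℝ) ^ 2 * B * K ^ 2 * (1 + Fintype.card κ * C * K)
    + (Fintype.card κ : ℝ) ^ 2 * K ^ 2 * C, ?_⟩
  filter_upwards [(nhds_prod_eq (x := y₀) (y := y₀)) ▸ hprod.prod_mk hprod,
    Filter.eventually_all.2 hCE,
    Filter.eventually_all.2 fun i ↦ Filter.eventually_all.2 fun j ↦ hCS i j]
    with p ⟨⟨hp1, hpE1, hpS1⟩, ⟨hp2, hpE2, _⟩⟩ hpE hpS a b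
  obtain ⟨c, hc⟩ : ∃ c : κ → ℝ, a = ∑ i, c i • Z i p.1 :=
    ⟨(hZ.toBasisAt hp1).repr a, by simpa using ((hZ.toBasisAt hp1).sum_repr a).symm⟩
  obtain ⟨d, hd⟩ : ∃ d : κ → ℝ, b = ∑ i, d i • Z i p.2 :=
    ⟨(hZ.toBasisAt hp2).repr b, by simpa using ((hZ.toBasisAt hp2).sum_repr b).symm⟩
  have key := quadratic_frame_estimate hK.le hB hC (norm_nonneg (f p.1 - f p.2))
    (hKE _ hpE1) (hKE _ hpE2) (fun i ↦ (hpE i).trans (by gcongr; exact hCEC i)) hpS1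
    (fun i j ↦ (hpS i j).trans (by gcongr; exact hCSC i j)) c d
  have ha : mvfderiv 𝓘(ℝ, F) f p.1 a = ∑ i, c i • E p.1 i := by simp [hc, E]
  have hb : mvfderiv 𝓘(ℝ, F) f p.2 b = ∑ i, d i • E p.2 i := by simp [hd, E]
  rw [ha, hb, hc, hd, hess_sum_frame hf (hZ1 _ hp1), hess_sum_frame hf (hZ1 _ hp2)]
  exact key

theorem hess_zero (f : N → W) (y : N) :
    hess f y (0 : TangentSpace 𝓘(ℝ, F) y) (0 : TangentSpace 𝓘(ℝ, F) y) = 0 := by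
  simp [hess, hessField]

variable [CompactSpace N]

/-- The local difference estimate, taken at equal points with one vector zero, is the quadratic
bound; compactness makes it uniform. -/
theorem exists_hess_le {f : N → W} (hf : ContMDiff 𝓘(ℝ, F) 𝓘(ℝ, W) ∞ f)
    (hinj : ∀ y, Function.Injective (mvfderiv 𝓘(ℝ, F) f y)) :
    ∃ C : ℝ, 0 ≤ C ∧ ∀ (y : N) (a : TangentSpace 𝓘(ℝ, F) y),
      ‖hess f y a a‖ ≤ C * ‖mvfderiv 𝓘(ℝ, F) f y a‖ ^ 2 := by
  refine exists_uniform_bound (P := fun y C ↦ ∀ a : TangentSpace 𝓘(ℝ, F) y,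
      ‖hess f y a a‖ ≤ C * ‖mvfderiv 𝓘(ℝ, F) f y a‖ ^ 2)
    (fun y C C' hC h a ↦ (h a).trans (by gcongr)) fun y₀ ↦ ?_
  obtain ⟨C, hC⟩ := exists_local_hess_sub_le hf hinj y₀
  refine ⟨C, ?_⟩
  filter_upwards [(Filter.tendsto_id.prodMk_nhds Filter.tendsto_id).eventually hC] with y hy a
  have := hy a 0
  simp only [id, hess_zero, map_zero, sub_zero, sub_self, norm_zero, zero_mul, add_zero] at this
  linarith

/-- Near the diagonal of `N × N` this is the local estimate. Away from it injectivity bounds `‖f y -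
f z‖` below, so the term carrying this factor dominates the quadratic bounds of both Hessians. -/
theorem exists_hess_sub_le {f : N → W} (hf : ContMDiff 𝓘(ℝ, F) 𝓘(ℝ, W) ∞ f)
    (hinj : ∀ y, Function.Injective (mvfderiv 𝓘(ℝ, F) f y)) (hf' : Function.Injective f) :
    ∃ C : ℝ, 0 ≤ C ∧ ∀ (y z : N) (a : TangentSpace 𝓘(ℝ, F) y) (b : TangentSpace 𝓘(ℝ, F) z),
      ‖hess f y a a - hess f z b b‖ ≤
        C * (‖mvfderiv 𝓘(ℝ, F) f y a - mvfderiv 𝓘(ℝ, F) f z b‖ + ‖f y - f z‖ *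
          (‖mvfderiv 𝓘(ℝ, F) f y a‖ + ‖mvfderiv 𝓘(ℝ, F) f z b‖)) *
          (‖mvfderiv 𝓘(ℝ, F) f y a‖ + ‖mvfderiv 𝓘(ℝ, F) f z b‖) := by
  obtain ⟨C₁, hC₁, hb⟩ := exists_hess_le hf hinj
  have := exists_uniform_bound (X := N × N) (P := fun p C ↦
      ∀ (a : TangentSpace 𝓘(ℝ, F) p.1) (b : TangentSpace 𝓘(ℝ, F) p.2),
      ‖hess f p.1 a a - hess f p.2 b b‖ ≤
        C * (‖mvfderiv 𝓘(ℝ, F) f p.1 a - mvfderiv 𝓘(ℝ, F) f p.2 b‖ + ‖f p.1 - f p.2‖ *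
          (‖mvfderiv 𝓘(ℝ, F) f p.1 a‖ + ‖mvfderiv 𝓘(ℝ, F) f p.2 b‖)) *
          (‖mvfderiv 𝓘(ℝ, F) f p.1 a‖ + ‖mvfderiv 𝓘(ℝ, F) f p.2 b‖))
    (fun p C C' hC h a b ↦ (h a b).trans (by gcongr)) ?_
  · obtain ⟨C, hC, h⟩ := this
    exact ⟨C, hC, fun y z a b ↦ h (y, z) a b⟩
  rintro ⟨y, z⟩
  by_cases hyz : y = z
  · subst hyz
    exact exists_local_hess_sub_le hf hinj y
  have hpos : 0 < ‖f y - f z‖ := norm_pos_iff.2 (sub_ne_zero.2 fun h ↦ hyz (hf' h))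
  have hcont : Continuous fun p : N × N ↦ ‖f p.1 - f p.2‖ :=
    ((hf.continuous.comp continuous_fst).sub (hf.continuous.comp continuous_snd)).norm
  refine ⟨C₁ * (2 / ‖f y - f z‖), ?_⟩
  filter_upwards [(hcont.tendsto (y, z)).eventually_const_lt (half_lt_self hpos)] with p hp a b
  set α := mvfderiv 𝓘(ℝ, F) f p.1 a
  set β := mvfderiv 𝓘(ℝ, F) f p.2 b
  have hδ : 1 ≤ 2 / ‖f y - f z‖ * ‖f p.1 - f p.2‖ := by
    rw [div_mul_eq_mul_div, one_le_div hpos]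
    linarith
  calc ‖hess f p.1 a a - hess f p.2 b b‖ ≤ C₁ * ‖α‖ ^ 2 + C₁ * ‖β‖ ^ 2 :=
        (norm_sub_le _ _).trans (add_le_add (hb _ _) (hb _ _))
    _ ≤ C₁ * (1 * (‖α‖ + ‖β‖) ^ 2) := by
        have : ‖α‖ ^ 2 + ‖β‖ ^ 2 ≤ 1 * (‖α‖ + ‖β‖) ^ 2 := by
          nlinarith [mul_nonneg (norm_nonneg α) (norm_nonneg β)]
        nlinarith
    _ ≤ C₁ * (2 / ‖f y - f z‖ * ‖f p.1 - f p.2‖ * (‖α‖ + ‖β‖) ^ 2) := by gcongr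
    _ = C₁ * (2 / ‖f y - f z‖) * (0 + ‖f p.1 - f p.2‖ * (‖α‖ + ‖β‖)) * (‖α‖ + ‖β‖) := by ring
    _ ≤ _ := by gcongr; exact norm_nonneg _

end HessianBounds

section HessianInner

variable {F : Type*} [NormedAddCommGroup F] [NormedSpace ℝ F] [FiniteDimensional ℝ F]
  {N : Type*} [TopologicalSpace N] [ChartedSpace F N] [IsManifold 𝓘(ℝ, F) ∞ N]
  [RiemannianBundle (fun y : N ↦ TangentSpace 𝓘(ℝ, F) y)]
  [IsContMDiffRiemannianBundle 𝓘(ℝ, F) ∞ F (fun y : N ↦ TangentSpace 𝓘(ℝ, F) y)]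
  {W : Type*} [NormedAddCommGroup W] [InnerProductSpace ℝ W] [CompactSpace N]

/-- Uniform bounds on the Hessian of an embedding of a compact manifold. -/
theorem exists_hess_bounds {f : N → W} (hf : ContMDiff 𝓘(ℝ, F) 𝓘(ℝ, W) ∞ f)
    (hinj : ∀ y, Function.Injective (mvfderiv 𝓘(ℝ, F) f y)) (hf' : Function.Injective f) :
    ∃ C : ℝ, 0 ≤ C ∧ (∀ (y : N) (a : TangentSpace 𝓘(ℝ, F) y),
      ‖hess f y a a‖ ≤ C * ‖mvfderiv 𝓘(ℝ, F) f y a‖ ^ 2) ∧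
      ∀ (y z : N) (a : TangentSpace 𝓘(ℝ, F) y) (b : TangentSpace 𝓘(ℝ, F) z),
      |inner ℝ (f y - f z) (hess f y a a - hess f z b b)| ≤
        ‖mvfderiv 𝓘(ℝ, F) f y a - mvfderiv 𝓘(ℝ, F) f z b‖ ^ 2 + C * ‖f y - f z‖ ^ 2 *
          (‖mvfderiv 𝓘(ℝ, F) f y a‖ ^ 2 + ‖mvfderiv 𝓘(ℝ, F) f z b‖ ^ 2) := by
  obtain ⟨C₁, hC₁, h₁⟩ := exists_hess_le hf hinj
  obtain ⟨C₂, hC₂, h₂⟩ := exists_hess_sub_le hf hinj hf'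
  refine ⟨C₁ + 2 * (C₂ ^ 2 + C₂), by positivity, fun y a ↦ (h₁ y a).trans ?_, fun y z a b ↦ ?_⟩
  · have : 0 ≤ 2 * (C₂ ^ 2 + C₂) := by positivity
    gcongr
    linarith
  have h := h₂ y z a b
  set α := mvfderiv 𝓘(ℝ, F) f y a
  set β := mvfderiv 𝓘(ℝ, F) f z b
  set δ := ‖f y - f z‖
  set t := ‖α - β‖
  set s := ‖α‖ + ‖β‖ with hs
  have hδ : 0 ≤ δ := norm_nonneg _
  have ht : 0 ≤ t := norm_nonneg _
  have hs0 : 0 ≤ s := by positivity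
  have hs2 : s ^ 2 ≤ 2 * (‖α‖ ^ 2 + ‖β‖ ^ 2) := by
    rw [hs]; nlinarith [sq_nonneg (‖α‖ - ‖β‖)]
  calc |inner ℝ (f y - f z) (hess f y a a - hess f z b b)|
      ≤ δ * (C₂ * (t + δ * s) * s) :=
        (abs_real_inner_le_norm _ _).trans (mul_le_mul_of_nonneg_left h hδ)
    -- Young's inequality on `C₂ * δ * t * s`. The coefficient `1` of `t ^ 2` is what the second
    -- derivative of the squared distance can absorb.
    _ ≤ t ^ 2 + (C₂ ^ 2 + C₂) * δ ^ 2 * s ^ 2 := by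
        nlinarith [sq_nonneg (2 * t - C₂ * δ * s), sq_nonneg (C₂ * δ * s), sq_nonneg t]
    _ ≤ t ^ 2 + (C₂ ^ 2 + C₂) * δ ^ 2 * (2 * (‖α‖ ^ 2 + ‖β‖ ^ 2)) := by gcongr
    _ ≤ _ := by
        have : 0 ≤ C₁ * (δ ^ 2 * (‖α‖ ^ 2 + ‖β‖ ^ 2)) := by positivity
        nlinarith

end HessianInner

/-! ### The pull-back connection seen in a vector space. -/

section Pullback

variable {E : Type*} [NormedAddCommGroup E] [NormedSpace ℝ E] [FiniteDimensional ℝ E]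
  {M : Type*} [TopologicalSpace M] [ChartedSpace E M] [IsManifold 𝓘(ℝ, E) ∞ M]
  {F : Type*} [NormedAddCommGroup F] [NormedSpace ℝ F] [FiniteDimensional ℝ F]
  {N : Type*} [TopologicalSpace N] [ChartedSpace F N] [IsManifold 𝓘(ℝ, F) ∞ N]
  [RiemannianBundle (fun y : N ↦ TangentSpace 𝓘(ℝ, F) y)]
  [IsContMDiffRiemannianBundle 𝓘(ℝ, F) ∞ F (fun y : N ↦ TangentSpace 𝓘(ℝ, F) y)]
  {W : Type*} [NormedAddCommGroup W] [NormedSpace ℝ W]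

theorem mdifferentiableAt_mvfderiv_symm {h : N → W} (hh : ContMDiff 𝓘(ℝ, F) 𝓘(ℝ, W) ∞ h) (y : N)
    (z : N × F) (hz : z.1 ∈ (trivializationAt F (fun y : N ↦ TangentSpace 𝓘(ℝ, F) y) y).baseSet) :
    MDifferentiableAt (𝓘(ℝ, F).prod 𝓘(ℝ, F)) 𝓘(ℝ, W) (fun z : N × F ↦ mvfderiv 𝓘(ℝ, F) h z.1
      ((trivializationAt F (fun y : N ↦ TangentSpace 𝓘(ℝ, F) y) y).symm z.1 z.2)) z := by
  set e := trivializationAt F (fun y : N ↦ TangentSpace 𝓘(ℝ, F) y) y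
  have h1 := (e.contMDiffOn_symm (IB := 𝓘(ℝ, F)) (n := ∞)).contMDiffAt
    (e.open_target.mem_nhds (e.mem_target.2 hz))
  have h2 := ((contMDiff_mvfderiv_totalSpace hh).contMDiffAt.comp z h1).mdifferentiableAt (by simp)
  refine h2.congr_of_eventuallyEq ?_
  filter_upwards [(e.open_baseSet.preimage continuous_fst).mem_nhds hz] with q hq
  have := e.mk_symm hq q.2
  simp only [Function.comp]
  rw [← this]

/-- The derivative of a map into a vector space turns the pull-back connection into the flat one,
up to the Hessian. -/
theorem mvfderiv_pullbackConnection {h : N → W} (hh : ContMDiff 𝓘(ℝ, F) 𝓘(ℝ, W) ∞ h)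
    {f : M → N} {x : M} {s : ∀ p : M, TangentSpace 𝓘(ℝ, F) (f p)}
    (hs : MDifferentiableAt 𝓘(ℝ, E) 𝓘(ℝ, F).tangent
      (fun p ↦ (⟨f p, s p⟩ : TangentBundle 𝓘(ℝ, F) N)) x) (w : TangentSpace 𝓘(ℝ, E) x) :
    mvfderiv 𝓘(ℝ, F) h (f x) (pullbackConnection f s x w) =
      mvfderiv 𝓘(ℝ, E) (fun p ↦ mvfderiv 𝓘(ℝ, F) h (f p) (s p)) x w
        - hess h (f x) (s x) (mfderiv 𝓘(ℝ, E) 𝓘(ℝ, F) f x w) := by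
  set e := trivializationAt F (fun y : N ↦ TangentSpace 𝓘(ℝ, F) y) (f x) with he
  have hx : f x ∈ e.baseSet := FiberBundle.mem_baseSet_trivializationAt' (f x)
  have hf : MDifferentiableAt 𝓘(ℝ, E) 𝓘(ℝ, F) f x :=
    ((contMDiff_proj (n := ∞) (fun y : N ↦ TangentSpace 𝓘(ℝ, F) y)).mdifferentiable (by simp)
      _).comp x hs
  set σ : M → F := fun p ↦ (e ⟨f p, s p⟩).2 with hσ
  have hσx : MDifferentiableAt 𝓘(ℝ, E) 𝓘(ℝ, F) σ x := by
    have h1 := (e.contMDiffOn (IB := 𝓘(ℝ, F)) (n := ∞)).contMDiffAt (x := ⟨f x, s x⟩)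
      (e.open_source.mem_nhds (e.mem_source.2 hx))
    have h2 := (h1.mdifferentiableAt (by simp)).comp x hs
    exact (mdifferentiableAt_snd (I := 𝓘(ℝ, F)) (I' := 𝓘(ℝ, F))).comp x h2
  set G : N × F → W := fun z ↦ mvfderiv 𝓘(ℝ, F) h z.1 (e.symm z.1 z.2) with hG
  have hGd := mdifferentiableAt_mvfderiv_symm hh (f x) (f x, σ x) hx
  have heq : (fun p ↦ mvfderiv 𝓘(ℝ, F) h (f p) (s p)) =ᶠ[𝓝 x] fun p ↦ G (f p, σ p) := by
    filter_upwards [hf.continuousAt.preimage_mem_nhds (e.open_baseSet.mem_nhds hx)] with p hp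
    simp only [G, σ]
    rw [e.symm_apply_apply_mk hp]
  -- In the trivialization the section becomes a pair `(f p, σ p)`. Varying the base point with
  -- frozen coordinates gives the part that meets the Hessian; varying the coordinates is linear and
  -- gives the first term of the pull-back connection.
  have hchain : mvfderiv 𝓘(ℝ, E) (fun p ↦ mvfderiv 𝓘(ℝ, F) h (f p) (s p)) x w =
      mvfderiv 𝓘(ℝ, F) (fun q ↦ G (q, σ x)) (f x) (mfderiv 𝓘(ℝ, E) 𝓘(ℝ, F) f x w)
        + mvfderiv 𝓘(ℝ, F) (fun ξ ↦ G (f x, ξ)) (σ x) (mvfderiv 𝓘(ℝ, E) σ x w) := by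
    have h1 := (hGd.hasMFDerivAt.comp x (hf.hasMFDerivAt.prodMk hσx.hasMFDerivAt)
      ).congr_of_eventuallyEq heq
    have h2 := DFunLike.congr_fun h1.mfderiv w
    exact h2.trans (mfderiv_prod_eq_add_apply hGd)
  have hlin : mvfderiv 𝓘(ℝ, F) (fun ξ ↦ G (f x, ξ)) (σ x) (mvfderiv 𝓘(ℝ, E) σ x w) =
      mvfderiv 𝓘(ℝ, F) h (f x) (e.symm (f x) (mvfderiv 𝓘(ℝ, E) σ x w)) := by
    have h1 : (fun ξ ↦ G (f x, ξ)) =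
        ((mvfderiv 𝓘(ℝ, F) h (f x)).comp (e.symmL ℝ (f x)) : F →L[ℝ] W) := by
      ext ξ
      simp [G, e.symmL_apply hx]
    rw [h1, ← e.symmL_apply (R := ℝ) hx]
    exact DFunLike.congr_fun (ContinuousLinearMap.mfderiv_eq
      ((mvfderiv 𝓘(ℝ, F) h (f x)).comp (e.symmL ℝ (f x)) : F →L[ℝ] W)) _
  rw [hchain, hlin, pullbackConnection, map_add, hess, hessField]
  -- `FiberBundle.extend` is by definition the field with constant coordinates in the trivialization
  -- at `f x`.
  have hext : (fun q ↦ G (q, σ x)) =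
      fun q ↦ mvfderiv 𝓘(ℝ, F) h q (FiberBundle.extend F (s x) q) := rfl
  rw [hext]
  abel

end Pullback

/-! ### Differentiation along straight lines in a chart. -/

section Lines

variable {E : Type*} [NormedAddCommGroup E] [NormedSpace ℝ E] [FiniteDimensional ℝ E]
  {M : Type*} [TopologicalSpace M] [ChartedSpace E M] [IsManifold 𝓘(ℝ, E) ∞ M]
  {W : Type*} [NormedAddCommGroup W] [NormedSpace ℝ W]

/-- The straight line in the coordinates at `x`. -/
noncomputable def coordLine (x : M) (v : TangentSpace 𝓘(ℝ, E) x) (s : ℝ) : E :=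
  let w : E := v
  extChartAt 𝓘(ℝ, E) x x + s • w

/-- The straight line in the chart at `x`. -/
noncomputable def chartLine (x : M) (v : TangentSpace 𝓘(ℝ, E) x) (s : ℝ) : M :=
  (extChartAt 𝓘(ℝ, E) x).symm (coordLine x v s)

theorem coordLine_zero (x : M) (v : TangentSpace 𝓘(ℝ, E) x) :
    coordLine x v 0 = extChartAt 𝓘(ℝ, E) x x :=
  (congrArg _ (zero_smul ℝ (show E from v))).trans (add_zero _)

theorem hasDerivAt_coordLine (x : M) (v : TangentSpace 𝓘(ℝ, E) x) (s : ℝ) :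
    HasDerivAt (coordLine x v) (show E from v) s := by
  have := ((hasDerivAt_id s).smul_const (show E from v)).const_add (extChartAt 𝓘(ℝ, E) x x)
  rw [one_smul] at this
  exact this

theorem chartLine_zero (x : M) (v : TangentSpace 𝓘(ℝ, E) x) : chartLine x v 0 = x := by
  rw [chartLine, coordLine_zero, extChartAt_to_inv]

theorem eventually_chartLine_mem (x : M) (v : TangentSpace 𝓘(ℝ, E) x) :
    ∀ᶠ s : ℝ in 𝓝 0, coordLine x v s ∈ (extChartAt 𝓘(ℝ, E) x).target := by
  refine (hasDerivAt_coordLine x v 0).continuousAt.preimage_mem_nhds ?_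
  rw [coordLine_zero]
  exact extChartAt_target_mem_nhds (I := 𝓘(ℝ, E)) x

theorem extend_tangent_eq_symm (x : M) (v : TangentSpace 𝓘(ℝ, E) x) (p : M) :
    FiberBundle.extend E v p = (trivializationAt E (TangentSpace 𝓘(ℝ, E)) x).symm p (v : E) := by
  have h : (trivializationAt E (TangentSpace 𝓘(ℝ, E)) x (⟨x, v⟩ : TangentBundle 𝓘(ℝ, E) M)).2
      = (v : E) := tangentCoordChange_self (mem_extChartAt_source x)
  exact congrArg _ h

/-- The tangent trivialization at `x` is the differential of the chart at `x`, so constant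
coordinates mean constant velocity in that chart: the line is an integral curve of the field
`FiberBundle.extend E v`. Hence its one-variable derivatives match those in the tension field. -/
theorem hasDerivAt_comp_chartLine {x : M} {v : TangentSpace 𝓘(ℝ, E) x} {s : ℝ}
    (hs : coordLine x v s ∈ (extChartAt 𝓘(ℝ, E) x).target) {g : M → W}
    (hg : MDifferentiableAt 𝓘(ℝ, E) 𝓘(ℝ, W) g (chartLine x v s)) :
    HasDerivAt (fun r ↦ g (chartLine x v r))
      (mvfderiv 𝓘(ℝ, E) g (chartLine x v s) (FiberBundle.extend E v (chartLine x v s))) s := by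
  set ξ := coordLine x v s with hξ
  have hsrc : chartLine x v s ∈ (chartAt E x).source := by
    simpa [chartLine, ξ] using (extChartAt 𝓘(ℝ, E) x).map_target hs
  have h1 : MDifferentiableAt 𝓘(ℝ, E) 𝓘(ℝ, E) (extChartAt 𝓘(ℝ, E) x).symm ξ :=
    ((contMDiffOn_extChartAt_symm (n := ∞) x).contMDiffAt
      ((isOpen_extChartAt_target x).mem_nhds hs)).mdifferentiableAt (by simp)
  have h2 := hasDerivAt_coordLine x v s
  have h3 := (hg.hasMFDerivAt.comp ξ h1.hasMFDerivAt).hasFDerivAt.comp_hasDerivAt s h2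
  have hext : FiberBundle.extend E v (chartLine x v s) =
      mfderiv 𝓘(ℝ, E) 𝓘(ℝ, E) (extChartAt 𝓘(ℝ, E) x).symm ξ v := by
    have h4 := TangentBundle.symmL_trivializationAt (I := 𝓘(ℝ, E)) (𝕜 := ℝ) hsrc
    have h5 : extChartAt 𝓘(ℝ, E) x (chartLine x v s) = ξ := (extChartAt 𝓘(ℝ, E) x).right_inv hs
    rw [h5] at h4
    simp only [mfld_simps, mfderivWithin_univ] at h4
    exact (extend_tangent_eq_symm x v _).trans
      ((Trivialization.symmL_apply (R := ℝ) _ hsrc _).symm.trans (DFunLike.congr_fun h4 v))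
  rw [hext]
  exact h3

theorem hasDerivAt_line {h : M → W} (hh : ContMDiff 𝓘(ℝ, E) 𝓘(ℝ, W) ∞ h) (x : M)
    (v : TangentSpace 𝓘(ℝ, E) x) : ∀ᶠ s in 𝓝 0, HasDerivAt (fun r ↦ h (chartLine x v r))
      (mvfderiv 𝓘(ℝ, E) h (chartLine x v s) (FiberBundle.extend E v (chartLine x v s))) s :=
  (eventually_chartLine_mem x v).mono fun _ hs ↦
    hasDerivAt_comp_chartLine hs (hh.mdifferentiable (by simp) _)

theorem hasDerivAt_deriv_line {h : M → W} (hh : ContMDiff 𝓘(ℝ, E) 𝓘(ℝ, W) ∞ h) (x : M)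
    (v : TangentSpace 𝓘(ℝ, E) x) :
    HasDerivAt (fun s ↦ mvfderiv 𝓘(ℝ, E) h (chartLine x v s)
      (FiberBundle.extend E v (chartLine x v s)))
      (mvfderiv 𝓘(ℝ, E) (fun p ↦ mvfderiv 𝓘(ℝ, E) h p (FiberBundle.extend E v p)) x v) 0 := by
  have h0 : MDiffAt (fun p ↦ mvfderiv 𝓘(ℝ, E) h p (FiberBundle.extend E v p)) (chartLine x v 0) := by
    rw [chartLine_zero]
    exact mdifferentiableAt_mvfderiv_apply hh (FiberBundle.mdifferentiableAt_extend 𝓘(ℝ, E) E v)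
  have h1 := hasDerivAt_comp_chartLine (eventually_chartLine_mem x v).self_of_nhds h0
  rw [chartLine_zero, FiberBundle.extend_apply_self] at h1
  exact h1

end Lines

/-! ### The tension field through an embedding, and bounds on horizontal gradients. -/

section TensionField

variable {E : Type*} [NormedAddCommGroup E] [NormedSpace ℝ E] [FiniteDimensional ℝ E]
  {M : Type*} [TopologicalSpace M] [ChartedSpace E M] [IsManifold 𝓘(ℝ, E) ∞ M]
  [RiemannianBundle (fun x : M ↦ TangentSpace 𝓘(ℝ, E) x)]
  [IsContMDiffRiemannianBundle 𝓘(ℝ, E) ∞ E (fun x : M ↦ TangentSpace 𝓘(ℝ, E) x)]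
  {F : Type*} [NormedAddCommGroup F] [NormedSpace ℝ F] [FiniteDimensional ℝ F]
  {N : Type*} [TopologicalSpace N] [ChartedSpace F N] [IsManifold 𝓘(ℝ, F) ∞ N]
  [RiemannianBundle (fun y : N ↦ TangentSpace 𝓘(ℝ, F) y)]
  [IsContMDiffRiemannianBundle 𝓘(ℝ, F) ∞ F (fun y : N ↦ TangentSpace 𝓘(ℝ, F) y)]
  {W : Type*} [NormedAddCommGroup W] [NormedSpace ℝ W]

/-- The orthonormal basis of `H_x`, as tangent vectors. -/
noncomputable def horizBasis (H : HorizontalDistribution E M) (x : M)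
    (i : Fin (Module.finrank ℝ (H.fiber x))) : TangentSpace 𝓘(ℝ, E) x :=
  stdOrthonormalBasis ℝ (H.fiber x) i

theorem norm_horizBasis (H : HorizontalDistribution E M) (x : M)
    (i : Fin (Module.finrank ℝ (H.fiber x))) : ‖horizBasis H x i‖ = 1 :=
  (stdOrthonormalBasis ℝ (H.fiber x)).norm_eq_one i

/-- The drift of the operator `tensionField` on functions, up to sign. -/
noncomputable def drift (H : HorizontalDistribution E M) (x : M) : TangentSpace 𝓘(ℝ, E) x :=
  ∑ i, bottConnection H (FiberBundle.extend E (horizBasis H x i))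
    (FiberBundle.extend E (horizBasis H x i)) x + meanCurvature H x

/-- The second derivative of a function in the direction `v`, in the coordinates at `x`. -/
noncomputable def secondDeriv (g : M → W) (x : M) (v : TangentSpace 𝓘(ℝ, E) x) : W :=
  mvfderiv 𝓘(ℝ, E) (fun p ↦ mvfderiv 𝓘(ℝ, E) g p (FiberBundle.extend E v p)) x v

theorem mvfderiv_apply_mfderiv {h : N → W} (hh : ContMDiff 𝓘(ℝ, F) 𝓘(ℝ, W) ∞ h) {f : M → N}
    {x : M} (hf : MDiffAt f x) (v : TangentSpace 𝓘(ℝ, E) x) :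
    mvfderiv 𝓘(ℝ, F) h (f x) (mfderiv 𝓘(ℝ, E) 𝓘(ℝ, F) f x v) =
      mvfderiv 𝓘(ℝ, E) (fun p ↦ h (f p)) x v :=
  (mfderiv_comp_apply x (hh.mdifferentiable (by simp) _) hf v).symm

/-- The tension field, seen through a map to a vector space. -/
theorem mvfderiv_tensionField (H : HorizontalDistribution E M) {h : N → W}
    (hh : ContMDiff 𝓘(ℝ, F) 𝓘(ℝ, W) ∞ h) {f : M → N} (hf : ContMDiff 𝓘(ℝ, E) 𝓘(ℝ, F) ∞ f) (x : M) :
    mvfderiv 𝓘(ℝ, F) h (f x) (tensionField H f x) =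
      ∑ i, (secondDeriv (fun p ↦ h (f p)) x (horizBasis H x i) -
        hess h (f x) (mfderiv 𝓘(ℝ, E) 𝓘(ℝ, F) f x (horizBasis H x i))
          (mfderiv 𝓘(ℝ, E) 𝓘(ℝ, F) f x (horizBasis H x i)))
        - mvfderiv 𝓘(ℝ, E) (fun p ↦ h (f p)) x (drift H x) := by
  have hfd : MDiff f := hf.mdifferentiable (by simp)
  have key : ∀ v : TangentSpace 𝓘(ℝ, E) x,
      mvfderiv 𝓘(ℝ, F) h (f x) (secondFundamentalForm H f x v v) =
        secondDeriv (fun p ↦ h (f p)) x v - hess h (f x) (mfderiv 𝓘(ℝ, E) 𝓘(ℝ, F) f x v)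
          (mfderiv 𝓘(ℝ, E) 𝓘(ℝ, F) f x v)
        - mvfderiv 𝓘(ℝ, E) (fun p ↦ h (f p)) x
          (bottConnection H (FiberBundle.extend E v) (FiberBundle.extend E v) x) := by
    intro v
    have hs : MDifferentiableAt 𝓘(ℝ, E) 𝓘(ℝ, F).tangent
        (fun p ↦ (⟨f p, mfderiv 𝓘(ℝ, E) 𝓘(ℝ, F) f p (FiberBundle.extend E v p)⟩ :
          TangentBundle 𝓘(ℝ, F) N)) x :=
      MDifferentiableAt.comp (I' := 𝓘(ℝ, E).tangent) x
        ((hf.contMDiff_tangentMap (m := ∞) le_rfl).mdifferentiable (by simp) _)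
        (FiberBundle.mdifferentiableAt_extend 𝓘(ℝ, E) E v)
    have h1 := mvfderiv_pullbackConnection hh hs v
    have h2 : (fun p ↦ mvfderiv 𝓘(ℝ, F) h (f p)
        (mfderiv 𝓘(ℝ, E) 𝓘(ℝ, F) f p (FiberBundle.extend E v p))) =
        fun p ↦ mvfderiv 𝓘(ℝ, E) (fun p ↦ h (f p)) p (FiberBundle.extend E v p) :=
      funext fun p ↦ mvfderiv_apply_mfderiv hh (hfd p) _
    rw [h2, FiberBundle.extend_apply_self] at h1
    rw [secondFundamentalForm, map_sub, h1, mvfderiv_apply_mfderiv hh (hfd x), secondDeriv]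
  rw [tensionField, map_sub, map_sum, mvfderiv_apply_mfderiv hh (hfd x), drift, map_add, map_sum,
    ← sub_sub, ← Finset.sum_sub_distrib]
  congr 1
  exact Finset.sum_congr rfl fun i _ ↦ key _

/-- Locally, continuity of the metric bounds the coordinates of `v` by `‖v‖`, and the differential
on each coordinate field is bounded by continuity. -/
theorem exists_norm_mvfderiv_le [CompactSpace M] {g : M → W} (hg : ContMDiff 𝓘(ℝ, E) 𝓘(ℝ, W) ∞ g) :
    ∃ C, 0 ≤ C ∧ ∀ x (v : TangentSpace 𝓘(ℝ, E) x), ‖mvfderiv 𝓘(ℝ, E) g x v‖ ≤ C * ‖v‖ := by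
  refine exists_uniform_bound (P := fun x C ↦ ∀ v : TangentSpace 𝓘(ℝ, E) x,
    ‖mvfderiv 𝓘(ℝ, E) g x v‖ ≤ C * ‖v‖) (fun x C C' hC h v ↦ (h v).trans (by gcongr)) fun x₀ ↦ ?_
  set e := trivializationAt E (fun x : M ↦ TangentSpace 𝓘(ℝ, E) x) x₀
  have hx₀ : x₀ ∈ e.baseSet := FiberBundle.mem_baseSet_trivializationAt' x₀
  let b := Module.finBasis ℝ E
  obtain ⟨m, hm, hmi⟩ := IsContMDiffRiemannianBundle.exists_contMDiff (IB := 𝓘(ℝ, E)) (n := ∞)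
    (F := E) (E := fun x : M ↦ TangentSpace 𝓘(ℝ, E) x)
  have : IsContinuousRiemannianBundle E (fun x : M ↦ TangentSpace 𝓘(ℝ, E) x) :=
    ⟨m, hm.continuous, hmi⟩
  obtain ⟨C, hC, hCe⟩ := eventually_norm_trivializationAt_lt E (TangentSpace 𝓘(ℝ, E)) x₀
  have hG : ∀ i, ContinuousAt (fun y ↦ mvfderiv 𝓘(ℝ, E) g y (e.symm y (b i))) x₀ := fun i ↦
    ContinuousAt.comp (f := fun y ↦ (y, b i)) (x := x₀)
      (mdifferentiableAt_mvfderiv_symm hg x₀ (x₀, b i) hx₀).continuousAt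
      (continuousAt_id.prodMk continuousAt_const)
  set B := ∑ i, ‖mvfderiv 𝓘(ℝ, E) g x₀ (e.symm x₀ (b i))‖ + 1
  have hB : ∀ᶠ y in 𝓝 x₀, ∀ i, ‖mvfderiv 𝓘(ℝ, E) g y (e.symm y (b i))‖ ≤ B := by
    refine Filter.eventually_all.2 fun i ↦ ?_
    have h1 : ‖mvfderiv 𝓘(ℝ, E) g x₀ (e.symm x₀ (b i))‖ < B := by
      have h2 := Finset.single_le_sum
        (f := fun i ↦ ‖mvfderiv 𝓘(ℝ, E) g x₀ (e.symm x₀ (b i))‖) (fun _ _ ↦ norm_nonneg _)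
        (Finset.mem_univ i)
      linarith
    exact ((hG i).norm.eventually_lt_const h1).mono fun _ h ↦ h.le
  have hB0 : 0 ≤ B := by positivity
  refine ⟨Module.finrank ℝ E * B * (‖(b.equivFunL : E →L[ℝ] Fin (Module.finrank ℝ E) → ℝ)‖ * C), ?_⟩
  filter_upwards [hCe, hB, e.open_baseSet.mem_nhds hx₀] with y hy hyB hye v
  set ξ : E := e.continuousLinearMapAt ℝ y v
  have hv : v = ∑ i, b.equivFun ξ i • e.symm y (b i) := by
    have h1 : e.symmL ℝ y ξ = v := e.symmL_continuousLinearMapAt hye v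
    rw [← h1]
    conv_lhs => rw [← b.sum_equivFun ξ]
    rw [map_sum]
    exact Finset.sum_congr rfl fun i _ ↦ by rw [map_smul, e.symmL_apply hye]
  have hξ : ‖ξ‖ ≤ C * ‖v‖ := (ContinuousLinearMap.le_opNorm _ _).trans (by gcongr)
  have hbξ : ‖b.equivFun ξ‖ ≤ ‖(b.equivFunL : E →L[ℝ] Fin (Module.finrank ℝ E) → ℝ)‖ * ‖ξ‖ :=
    ContinuousLinearMap.le_opNorm (b.equivFunL : E →L[ℝ] Fin (Module.finrank ℝ E) → ℝ) ξ
  have h2 : mvfderiv 𝓘(ℝ, E) g y v =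
      ∑ i, b.equivFun ξ i • mvfderiv 𝓘(ℝ, E) g y (e.symm y (b i)) := by
    conv_lhs => rw [hv]
    simp only [map_sum, map_smul]
  rw [h2]
  refine (norm_sum_smul_le _ hyB).trans ?_
  rw [Fintype.card_fin, mul_assoc _ _ ‖v‖, mul_assoc _ C]
  have : 0 ≤ ‖(b.equivFunL : E →L[ℝ] Fin (Module.finrank ℝ E) → ℝ)‖ := norm_nonneg _
  gcongr
  exact hbξ.trans (by gcongr)

/-- The chosen orthonormal basis of `H_x` need not vary continuously with `x`; only the unit length
of its vectors and the bound on its size are used. -/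
theorem exists_sum_horiz_le [CompactSpace M] (H : HorizontalDistribution E M) {g : M → W}
    (hg : ContMDiff 𝓘(ℝ, E) 𝓘(ℝ, W) ∞ g) :
    ∃ C, ∀ x, ∑ i, ‖mvfderiv 𝓘(ℝ, E) g x (horizBasis H x i)‖ ^ 2 ≤ C := by
  obtain ⟨C, hC, h⟩ := exists_norm_mvfderiv_le hg
  refine ⟨Module.finrank ℝ E * C ^ 2, fun x ↦ ?_⟩
  calc ∑ i, ‖mvfderiv 𝓘(ℝ, E) g x (horizBasis H x i)‖ ^ 2
      ≤ ∑ _i : Fin (Module.finrank ℝ (H.fiber x)), C ^ 2 := Finset.sum_le_sum fun i _ ↦ by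
        have := h x (horizBasis H x i)
        rw [norm_horizBasis, mul_one] at this
        gcongr
    _ = Module.finrank ℝ (H.fiber x) * C ^ 2 := by simp
    _ ≤ _ := by
        have : Module.finrank ℝ (H.fiber x) ≤ Module.finrank ℝ E := Submodule.finrank_le (H.fiber x)
        gcongr

end TensionField

/-! ### The maximum principle for the weighted distance. -/

section MaximumPrinciple

variable {E : Type*} [NormedAddCommGroup E] [NormedSpace ℝ E] [FiniteDimensional ℝ E]
  {M : Type*} [TopologicalSpace M] [ChartedSpace E M] [IsManifold 𝓘(ℝ, E) ∞ M]
  [RiemannianBundle (fun x : M ↦ TangentSpace 𝓘(ℝ, E) x)]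
  [IsContMDiffRiemannianBundle 𝓘(ℝ, E) ∞ E (fun x : M ↦ TangentSpace 𝓘(ℝ, E) x)]
  {F : Type*} [NormedAddCommGroup F] [NormedSpace ℝ F] [FiniteDimensional ℝ F]
  {N : Type*} [TopologicalSpace N] [ChartedSpace F N] [IsManifold 𝓘(ℝ, F) ∞ N]
  [RiemannianBundle (fun y : N ↦ TangentSpace 𝓘(ℝ, F) y)]
  [IsContMDiffRiemannianBundle 𝓘(ℝ, F) ∞ F (fun y : N ↦ TangentSpace 𝓘(ℝ, F) y)]
  {W : Type*} [NormedAddCommGroup W] [InnerProductSpace ℝ W]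

/-- The two bounds on the Hessian of an embedding that the maximum principle uses. -/
def HessBound (h : N → W) (C : ℝ) : Prop :=
  0 ≤ C ∧ (∀ (y : N) (a : TangentSpace 𝓘(ℝ, F) y),
    ‖hess h y a a‖ ≤ C * ‖mvfderiv 𝓘(ℝ, F) h y a‖ ^ 2) ∧
  ∀ (y z : N) (a : TangentSpace 𝓘(ℝ, F) y) (b : TangentSpace 𝓘(ℝ, F) z),
    |inner ℝ (h y - h z) (hess h y a a - hess h z b b)| ≤
      ‖mvfderiv 𝓘(ℝ, F) h y a - mvfderiv 𝓘(ℝ, F) h z b‖ ^ 2 + C * ‖h y - h z‖ ^ 2 *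
        (‖mvfderiv 𝓘(ℝ, F) h y a‖ ^ 2 + ‖mvfderiv 𝓘(ℝ, F) h z b‖ ^ 2)

variable (F) in
/-- The image of the tension field of `f` under the differential of `h`. -/
noncomputable def tensionImage (H : HorizontalDistribution E M) (h : N → W) (f : M → N) (x : M) :
    W :=
  mvfderiv 𝓘(ℝ, F) h (f x) (tensionField H f x)

theorem mvfderiv_extend_chartLine_zero (g : M → W) (x : M) (v : TangentSpace 𝓘(ℝ, E) x) :
    mvfderiv 𝓘(ℝ, E) g (chartLine x v 0) (FiberBundle.extend E v (chartLine x v 0)) =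
      mvfderiv 𝓘(ℝ, E) g x v := by
  have h : ∀ y, y = x →
      mvfderiv 𝓘(ℝ, E) g y (FiberBundle.extend E v y) = mvfderiv 𝓘(ℝ, E) g x v := by
    rintro _ rfl
    rw [FiberBundle.extend_apply_self]
  exact h _ (chartLine_zero x v)

/-- The spatial maximum is used on chart lines: to second order along each horizontal basis vector,
to first order along the drift. Together with the formula for the tension field, this supplies the
hypotheses of `growth_rate_le`. -/
theorem growth_rate_le_of_isMax (H : HorizontalDistribution E M) {h : N → W}
    (hh : ContMDiff 𝓘(ℝ, F) 𝓘(ℝ, W) ∞ h) {a b p : M → N}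
    (ha : ContMDiff 𝓘(ℝ, E) 𝓘(ℝ, F) ∞ a) (hb : ContMDiff 𝓘(ℝ, E) 𝓘(ℝ, F) ∞ b)
    (hp : ContMDiff 𝓘(ℝ, E) 𝓘(ℝ, F) ∞ p) {x : M} {C C' η L K : ℝ} (hC : HessBound (F := F) h C)
    (hL : L = 2 * C + 2) (hw : h (a x) ≠ h (b x)) (hf : ‖h (a x) - h (p x)‖ ≤ η)
    (hg : ‖h (b x) - h (p x)‖ ≤ η) (hCη : 2 * L * η * C ≤ 1) (hLη : 16 * L ^ 2 * η ^ 2 ≤ 1)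
    (hmax : ∀ y, ‖h (a y) - h (b y)‖ ^ 2 *
        Real.exp (L * (‖h (a y) - h (p y)‖ ^ 2 + ‖h (b y) - h (p y)‖ ^ 2)) ≤
      ‖h (a x) - h (b x)‖ ^ 2 *
        Real.exp (L * (‖h (a x) - h (p x)‖ ^ 2 + ‖h (b x) - h (p x)‖ ^ 2)))
    (ht : K * ‖h (a x) - h (b x)‖ ^ 2 ≤
      2 * inner ℝ (h (a x) - h (b x)) (tensionImage F H h a x - tensionImage F H h b x) +
        L * ‖h (a x) - h (b x)‖ ^ 2 * (2 * inner ℝ (h (a x) - h (p x)) (tensionImage F H h a x) +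
          2 * inner ℝ (h (b x) - h (p x)) (tensionImage F H h b x)))
    (hχ : ∑ i, ‖mvfderiv 𝓘(ℝ, E) (fun y ↦ h (p y)) x (horizBasis H x i)‖ ^ 2 ≤ C')
    (hpt : ‖tensionImage F H h p x‖ ≤ C') :
    K ≤ (4 + 4 * L) * C' + 4 * L * η * C' := by
  have sa : ContMDiff 𝓘(ℝ, E) 𝓘(ℝ, W) ∞ (fun y ↦ h (a y)) := hh.comp ha
  have sb : ContMDiff 𝓘(ℝ, E) 𝓘(ℝ, W) ∞ (fun y ↦ h (b y)) := hh.comp hb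
  have sp : ContMDiff 𝓘(ℝ, E) 𝓘(ℝ, W) ∞ (fun y ↦ h (p y)) := hh.comp hp
  -- The maximum is over all of `M`, so the values of the line outside the chart cause no trouble.
  have hloc : ∀ v : TangentSpace 𝓘(ℝ, E) x, IsLocalMax (fun s ↦
      ‖h (a (chartLine x v s)) - h (b (chartLine x v s))‖ ^ 2 *
        Real.exp (L * (‖h (a (chartLine x v s)) - h (p (chartLine x v s))‖ ^ 2 +
          ‖h (b (chartLine x v s)) - h (p (chartLine x v s))‖ ^ 2))) 0 := fun v ↦
    Filter.Eventually.of_forall fun s ↦ by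
      have := hmax (chartLine x v s)
      simpa only [chartLine_zero] using this
  refine growth_rate_le (κ := Fin (Module.finrank ℝ (H.fiber x)))
    (w := h (a x) - h (b x)) (f := h (a x) - h (p x)) (g := h (b x) - h (p x))
    (wt := tensionImage F H h a x - tensionImage F H h b x)
    (ft := tensionImage F H h a x) (gt := tensionImage F H h b x) (pt := tensionImage F H h p x)
    (wb := mvfderiv 𝓘(ℝ, E) (fun y ↦ h (a y)) x (drift H x)
      - mvfderiv 𝓘(ℝ, E) (fun y ↦ h (b y)) x (drift H x))
    (fb := mvfderiv 𝓘(ℝ, E) (fun y ↦ h (a y)) x (drift H x)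
      - mvfderiv 𝓘(ℝ, E) (fun y ↦ h (p y)) x (drift H x))
    (gb := mvfderiv 𝓘(ℝ, E) (fun y ↦ h (b y)) x (drift H x)
      - mvfderiv 𝓘(ℝ, E) (fun y ↦ h (p y)) x (drift H x))
    (α := fun i ↦ mvfderiv 𝓘(ℝ, E) (fun y ↦ h (a y)) x (horizBasis H x i))
    (β := fun i ↦ mvfderiv 𝓘(ℝ, E) (fun y ↦ h (b y)) x (horizBasis H x i))
    (χ := fun i ↦ mvfderiv 𝓘(ℝ, E) (fun y ↦ h (p y)) x (horizBasis H x i))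
    (A := fun i ↦ hess h (a x) (mfderiv 𝓘(ℝ, E) 𝓘(ℝ, F) a x (horizBasis H x i))
      (mfderiv 𝓘(ℝ, E) 𝓘(ℝ, F) a x (horizBasis H x i)))
    (B := fun i ↦ hess h (b x) (mfderiv 𝓘(ℝ, E) 𝓘(ℝ, F) b x (horizBasis H x i))
      (mfderiv 𝓘(ℝ, E) 𝓘(ℝ, F) b x (horizBasis H x i)))
    (P := fun i ↦ hess h (p x) (mfderiv 𝓘(ℝ, E) 𝓘(ℝ, F) p x (horizBasis H x i))
      (mfderiv 𝓘(ℝ, E) 𝓘(ℝ, F) p x (horizBasis H x i)))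
    (w2 := fun i ↦ secondDeriv (fun y ↦ h (a y)) x (horizBasis H x i)
      - secondDeriv (fun y ↦ h (b y)) x (horizBasis H x i))
    (f2 := fun i ↦ secondDeriv (fun y ↦ h (a y)) x (horizBasis H x i)
      - secondDeriv (fun y ↦ h (p y)) x (horizBasis H x i))
    (g2 := fun i ↦ secondDeriv (fun y ↦ h (b y)) x (horizBasis H x i)
      - secondDeriv (fun y ↦ h (p y)) x (horizBasis H x i))
    hC.1 hL (sub_ne_zero.2 hw) hf hg ?_ ?_ ?_ ?_ hCη hLη ?_ ?_ ht ?_ ?_ ?_ hχ hpt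
  · intro i
    rw [← mvfderiv_apply_mfderiv hh (ha.mdifferentiable (by simp) x)]
    exact hC.2.1 _ _
  · intro i
    rw [← mvfderiv_apply_mfderiv hh (hb.mdifferentiable (by simp) x)]
    exact hC.2.1 _ _
  · intro i
    rw [← mvfderiv_apply_mfderiv hh (hp.mdifferentiable (by simp) x)]
    exact hC.2.1 _ _
  · intro i
    rw [← mvfderiv_apply_mfderiv hh (ha.mdifferentiable (by simp) x),
      ← mvfderiv_apply_mfderiv hh (hb.mdifferentiable (by simp) x)]
    exact hC.2.2 _ _ _ _
  · intro i
    have := dist_weighted_max_second (hasDerivAt_line sa x (horizBasis H x i))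
      (hasDerivAt_line sb x (horizBasis H x i)) (hasDerivAt_line sp x (horizBasis H x i))
      (hasDerivAt_deriv_line sa x (horizBasis H x i))
      (hasDerivAt_deriv_line sb x (horizBasis H x i))
      (hasDerivAt_deriv_line sp x (horizBasis H x i)) (hloc _)
    simpa only [mvfderiv_extend_chartLine_zero, chartLine_zero, secondDeriv] using this
  · have := dist_weighted_max_first (hasDerivAt_line sa x (drift H x)).self_of_nhds
      (hasDerivAt_line sb x (drift H x)).self_of_nhds
      (hasDerivAt_line sp x (drift H x)).self_of_nhds (hloc _)
    simpa only [mvfderiv_extend_chartLine_zero, chartLine_zero, secondDeriv] using this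
  all_goals
    simp only [tensionImage, mvfderiv_tensionField H hh ha, mvfderiv_tensionField H hh hb,
      mvfderiv_tensionField H hh hp, Finset.sum_sub_distrib]
    abel

/-- Two families of maps that move by the tension field, agree initially, and stay close to a fixed
map, agree. -/
theorem eq_of_close [CompactSpace M] (H : HorizontalDistribution E M) {h : N → W}
    (hh : ContMDiff 𝓘(ℝ, F) 𝓘(ℝ, W) ∞ h) {C η t₀ t₁ : ℝ} (hC : HessBound (F := F) h C)
    (hCη : 2 * (2 * C + 2) * η * C ≤ 1) (hLη : 16 * (2 * C + 2) ^ 2 * η ^ 2 ≤ 1)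
    {u v : M → ℝ → N} {p : M → N}
    (hu : ∀ t ∈ Ioc t₀ t₁, ContMDiff 𝓘(ℝ, E) 𝓘(ℝ, F) ∞ (fun x ↦ u x t))
    (hv : ∀ t ∈ Ioc t₀ t₁, ContMDiff 𝓘(ℝ, E) 𝓘(ℝ, F) ∞ (fun x ↦ v x t))
    (hp : ContMDiff 𝓘(ℝ, E) 𝓘(ℝ, F) ∞ p)
    (hut : ∀ x, ∀ t ∈ Ioc t₀ t₁,
      HasDerivAt (fun s ↦ h (u x s)) (tensionImage F H h (fun y ↦ u y t) x) t)
    (hvt : ∀ x, ∀ t ∈ Ioc t₀ t₁,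
      HasDerivAt (fun s ↦ h (v x s)) (tensionImage F H h (fun y ↦ v y t) x) t)
    (huc : ContinuousOn (fun q : M × ℝ ↦ h (u q.1 q.2)) (univ ×ˢ Icc t₀ t₁))
    (hvc : ContinuousOn (fun q : M × ℝ ↦ h (v q.1 q.2)) (univ ×ˢ Icc t₀ t₁))
    (hup : ∀ x, ∀ t ∈ Icc t₀ t₁, ‖h (u x t) - h (p x)‖ ≤ η)
    (hvp : ∀ x, ∀ t ∈ Icc t₀ t₁, ‖h (v x t) - h (p x)‖ ≤ η)
    (h0 : ∀ x, u x t₀ = v x t₀) {C' : ℝ} (hpt : ∀ x, ‖tensionImage F H h p x‖ ≤ C') (x : M)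
    {t : ℝ} (ht : t ∈ Icc t₀ t₁) : h (u x t) = h (v x t) := by
  obtain ⟨C₂, hC₂⟩ := exists_sum_horiz_le H (hh.comp hp)
  set L := 2 * C + 2 with hL
  set D := max C' C₂
  -- One more than the bound that a positive maximum forces.
  set K := (4 + 4 * L) * D + 4 * L * η * D + 1 with hK
  by_contra hne
  set Q : M × ℝ → ℝ := fun q ↦ ‖h (u q.1 q.2) - h (v q.1 q.2)‖ ^ 2 * Real.exp (L *
    (‖h (u q.1 q.2) - h (p q.1)‖ ^ 2 + ‖h (v q.1 q.2) - h (p q.1)‖ ^ 2) - K * q.2) with hQ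
  have hpc : ContinuousOn (fun q : M × ℝ ↦ h (p q.1)) (univ ×ˢ Icc t₀ t₁) :=
    ((hh.continuous.comp hp.continuous).comp continuous_fst).continuousOn
  have hQc : ContinuousOn Q (univ ×ˢ Icc t₀ t₁) := by
    refine ((huc.sub hvc).norm.pow 2).mul (ContinuousOn.rexp ?_)
    exact ((((huc.sub hpc).norm.pow 2).add ((hvc.sub hpc).norm.pow 2)).const_smul L).sub
      (continuous_snd.continuousOn.const_smul K)
  obtain ⟨⟨z, s⟩, ⟨-, hs⟩, hmax⟩ := (isCompact_univ.prod isCompact_Icc).exists_isMaxOn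
    ⟨(x, t), mem_univ _, ht⟩ hQc
  have hs : s ∈ Icc t₀ t₁ := hs
  have hpos : 0 < Q (x, t) :=
    mul_pos (pow_pos (norm_pos_iff.2 (sub_ne_zero.2 hne)) 2) (Real.exp_pos _)
  have hposz : 0 < Q (z, s) := hpos.trans_le (hmax (show (x, t) ∈ univ ×ˢ Icc t₀ t₁ from
    ⟨mem_univ _, ht⟩))
  have hw : h (u z s) ≠ h (v z s) := fun hc ↦ by simp [hQ, hc] at hposz
  -- At `t₀` the two maps agree and `Q` vanishes, so a positive maximum lies at a later time, where
  -- both are smooth.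
  have hs0 : t₀ < s := lt_of_le_of_ne hs.1 fun hc ↦ hw (by rw [← hc, h0])
  have hs' : s ∈ Ioc t₀ t₁ := ⟨hs0, hs.2⟩
  have hle := growth_rate_le_of_isMax H hh (hu s hs') (hv s hs') hp hC hL hw (hup z s hs)
    (hvp z s hs) hCη hLη (K := K) (C' := D) ?_ ?_ ((hC₂ z).trans (le_max_right _ _))
    ((hpt z).trans (le_max_left _ _))
  · linarith
  · intro y
    have := hmax (show (y, s) ∈ univ ×ˢ Icc t₀ t₁ from ⟨mem_univ _, hs⟩)
    -- At the fixed time `s` the factor `exp (-K s)` is common to both sides.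
    simp only [hQ, mem_ofPred_eq, Real.exp_sub, mul_div_assoc'] at this
    exact (div_le_div_iff_of_pos_right (Real.exp_pos _)).1 this
  · exact dist_weighted_max_time hs0 (hut z s hs') (hvt z s hs') fun r hr ↦
      hmax (show (z, r) ∈ univ ×ˢ Icc t₀ t₁ from ⟨mem_univ _, hr.1, hr.2.trans hs.2⟩)

end MaximumPrinciple

/-! ### Regularity of solutions and propagation of agreement in time. -/

section Flow

variable {E : Type*} [NormedAddCommGroup E] [NormedSpace ℝ E] [FiniteDimensional ℝ E]
  {M : Type*} [TopologicalSpace M] [ChartedSpace E M] [IsManifold 𝓘(ℝ, E) ∞ M]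
  [RiemannianBundle (fun x : M ↦ TangentSpace 𝓘(ℝ, E) x)]
  [IsContMDiffRiemannianBundle 𝓘(ℝ, E) ∞ E (fun x : M ↦ TangentSpace 𝓘(ℝ, E) x)]
  {F : Type*} [NormedAddCommGroup F] [NormedSpace ℝ F] [FiniteDimensional ℝ F]
  {N : Type*} [TopologicalSpace N] [ChartedSpace F N] [IsManifold 𝓘(ℝ, F) ∞ N]
  [RiemannianBundle (fun y : N ↦ TangentSpace 𝓘(ℝ, F) y)]
  [IsContMDiffRiemannianBundle 𝓘(ℝ, F) ∞ F (fun y : N ↦ TangentSpace 𝓘(ℝ, F) y)]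
  {W : Type*} [NormedAddCommGroup W] [InnerProductSpace ℝ W]
  {H : HorizontalDistribution E M} {δ : EReal} {φ : M → N} {u v : M → ℝ → N}

theorem IsHeatFlow.contMDiffAt (hu : IsHeatFlow F H δ φ u) (x : M) {t : ℝ} (h0 : 0 < t)
    (ht : (t : EReal) < δ) :
    ContMDiffAt (𝓘(ℝ, E).prod 𝓘(ℝ, ℝ)) 𝓘(ℝ, F) ∞ (fun p : M × ℝ ↦ u p.1 p.2) (x, t) := by
  refine hu.contMDiffOn.contMDiffAt (IsOpen.mem_nhds ?_ ⟨h0, ht⟩)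
  exact (isOpen_lt continuous_const continuous_snd).inter
    (isOpen_lt (continuous_coe_real_ereal.comp continuous_snd) continuous_const)

theorem IsHeatFlow.contMDiff_slice (hu : IsHeatFlow F H δ φ u) {t : ℝ} (h0 : 0 < t)
    (ht : (t : EReal) < δ) : ContMDiff 𝓘(ℝ, E) 𝓘(ℝ, F) ∞ (fun x ↦ u x t) := fun x ↦
  ContMDiffAt.comp (f := fun y : M ↦ (y, t)) x (hu.contMDiffAt x h0 ht)
    (contMDiff_id.prodMk contMDiff_const).contMDiffAt

theorem IsHeatFlow.hasDerivAt (hu : IsHeatFlow F H δ φ u) {h : N → W}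
    (hh : ContMDiff 𝓘(ℝ, F) 𝓘(ℝ, W) ∞ h) (x : M) {t : ℝ} (h0 : 0 < t) (ht : (t : EReal) < δ) :
    HasDerivAt (fun s ↦ h (u x s)) (tensionImage F H h (fun y ↦ u y t) x) t := by
  have h1 : ContMDiffAt 𝓘(ℝ, ℝ) 𝓘(ℝ, F) ∞ (u x) t :=
    ContMDiffAt.comp (f := fun s : ℝ ↦ (x, s)) t (hu.contMDiffAt x h0 ht)
      (contMDiff_const.prodMk contMDiff_id).contMDiffAt
  have h2 : MDifferentiableAt 𝓘(ℝ, ℝ) 𝓘(ℝ, F) (u x) t := h1.mdifferentiableAt (by simp)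
  have h3 : MDifferentiableAt 𝓘(ℝ, F) 𝓘(ℝ, W) h (u x t) := hh.mdifferentiable (by simp) _
  have h4 : DifferentiableAt ℝ (h ∘ u x) t := (h3.comp t h2).differentiableAt
  have h5 := mfderiv_comp_apply t h3 h2 (1 : ℝ)
  have h6 : deriv (h ∘ u x) t = tensionImage F H h (fun y ↦ u y t) x := by
    rw [tensionImage, ← hu.equation x t h0 ht]
    refine Eq.trans ?_ h5
    rw [mfderiv_eq_fderiv]
    exact fderiv_apply_one_eq_deriv.symm
  rw [← h6]
  exact h4.hasDerivAt

/-- By the equation the tension is a time derivative, hence continuous in `x` by joint smoothness.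
This avoids any discussion of how the bases chosen in the tension field vary with `x`. -/
theorem IsHeatFlow.exists_norm_tensionImage_le [CompactSpace M] (hu : IsHeatFlow F H δ φ u)
    {h : N → W} (hh : ContMDiff 𝓘(ℝ, F) 𝓘(ℝ, W) ∞ h) {t : ℝ} (h0 : 0 < t)
    (ht : (t : EReal) < δ) : ∃ C, ∀ x, ‖tensionImage F H h (fun y ↦ u y t) x‖ ≤ C := by
  have h1 : ∀ x, tensionImage F H h (fun y ↦ u y t) x =
      (show ℝ →L[ℝ] W from mfderiv 𝓘(ℝ, ℝ) 𝓘(ℝ, W) (fun s ↦ h (u x s)) t) 1 := by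
    intro x
    rw [← (hu.hasDerivAt hh x h0 ht).deriv, mfderiv_eq_fderiv]
    exact fderiv_apply_one_eq_deriv.symm
  have h2 : Continuous (fun x ↦
      (show ℝ →L[ℝ] W from mfderiv 𝓘(ℝ, ℝ) 𝓘(ℝ, W) (fun s ↦ h (u x s)) t)) := by
    rw [continuous_iff_continuousAt]
    intro x
    have h3 : ContMDiffAt (𝓘(ℝ, E).prod 𝓘(ℝ, ℝ)) 𝓘(ℝ, W) ∞
        (Function.uncurry fun (y : M) (s : ℝ) ↦ h (u y s)) (x, t) :=
      ContMDiffAt.comp (g := h) (f := fun p : M × ℝ ↦ u p.1 p.2) (x, t) hh.contMDiffAt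
        (hu.contMDiffAt x h0 ht)
    have : IsManifold 𝓘(ℝ, E) 1 M := IsManifold.of_le (n := ∞) (by simp)
    have h4 := ContMDiffAt.mfderiv (m := 0) (J := 𝓘(ℝ, E)) (fun (y : M) (s : ℝ) ↦ h (u y s))
      (fun _ ↦ t) h3 contMDiffAt_const (by simp)
    have h5 := inTangentCoordinates_model_space (I := 𝓘(ℝ, ℝ)) (I' := 𝓘(ℝ, W)) (fun _ : M ↦ t)
      (fun y ↦ h (u y t)) (fun y ↦ mfderiv 𝓘(ℝ, ℝ) 𝓘(ℝ, W) (fun s ↦ h (u y s)) t) x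
    exact (h5 ▸ h4 :).continuousAt
  obtain ⟨C, hC⟩ := isCompact_univ.exists_bound_of_continuousOn
    (f := fun x ↦ tensionImage F H h (fun y ↦ u y t) x)
    (by simp only [h1]; exact (h2.clm_apply continuous_const).continuousOn)
  exact ⟨C, fun x ↦ hC x (mem_univ x)⟩

/-- Compactness of `M` makes continuity in time uniform in `x`. Composing with `projIcc` extends `g`
continuously to all times, so that ordinary neighbourhoods of `t₀` can be used. -/
theorem eventually_close [CompactSpace M] {g : M × ℝ → W} {t₀ T : ℝ} (hT : t₀ < T)
    (hg : ContinuousOn g (univ ×ˢ Icc t₀ T)) {ε : ℝ} (hε : 0 < ε) :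
    ∀ᶠ t in 𝓝 t₀, t ∈ Icc t₀ T → ∀ x, ‖g (x, t) - g (x, t₀)‖ ≤ ε := by
  have h1 : Continuous (fun q : ℝ × M ↦ g (q.2, projIcc t₀ T hT.le q.1)) :=
    hg.comp_continuous (continuous_snd.prodMk
      (continuous_subtype_val.comp (continuous_projIcc.comp continuous_fst)))
      fun q ↦ ⟨mem_univ _, (projIcc t₀ T hT.le q.1).2⟩
  have h2 : Continuous (fun q : ℝ × M ↦ ‖g (q.2, projIcc t₀ T hT.le q.1) - g (q.2, t₀)‖) :=
    (h1.sub (hg.comp_continuous (continuous_snd.prodMk continuous_const)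
      fun q ↦ ⟨mem_univ _, le_rfl, hT.le⟩)).norm
  have h3 := isCompact_univ.eventually_forall_of_forall_eventually (x₀ := t₀)
    (K := (univ : Set M))
    (P := fun t x ↦ ‖g (x, projIcc t₀ T hT.le t) - g (x, t₀)‖ < ε) fun x _ ↦ by
      refine (h2.tendsto (t₀, x)).eventually_lt_const ?_
      simpa [projIcc_left] using hε
  filter_upwards [h3] with t h ht x
  have := (h x (mem_univ x)).le
  rwa [projIcc_of_mem _ ht] at this

theorem IsHeatFlow.continuousOn_slab (hu : IsHeatFlow F H δ φ u) {h : N → W} (hh : Continuous h)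
    {t₀ T : ℝ} (h0 : 0 ≤ t₀) (hT : (T : EReal) < δ) :
    ContinuousOn (fun q : M × ℝ ↦ h (u q.1 q.2)) (univ ×ˢ Icc t₀ T) :=
  (hh.comp_continuousOn hu.continuousOn).mono fun _ hq ↦
    ⟨h0.trans hq.2.1, (EReal.coe_le_coe_iff.2 hq.2.2).trans_lt hT⟩

/-- Two solutions that agree at one time agree a little later. -/
theorem IsHeatFlow.exists_eq_later [CompactSpace M] (hu : IsHeatFlow F H δ φ u)
    (hv : IsHeatFlow F H δ φ v) {h : N → W} (hh : ContMDiff 𝓘(ℝ, F) 𝓘(ℝ, W) ∞ h)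
    (hinj : Function.Injective h) {C : ℝ} (hC : HessBound (F := F) h C) {t₀ T y : ℝ} (h0 : 0 ≤ t₀)
    (hT : t₀ < T) (hTδ : (T : EReal) < δ) (hy : t₀ < y) (heq : ∀ x, u x t₀ = v x t₀) :
    ∃ t₁ ∈ Ioc t₀ y, ∀ x, u x t₁ = v x t₁ := by
  have hC0 := hC.1
  -- For `L = 2 * C + 2` the two smallness conditions become `C / (2 * (C + 1)) ≤ 1` and `1 / (C +
  -- 1) ^ 2 ≤ 1`.
  set η := 1 / (8 * (C + 1) ^ 2) with hη
  have hη0 : 0 < η := by positivity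
  have hCη : 2 * (2 * C + 2) * η * C ≤ 1 := by
    rw [hη, mul_one_div, div_mul_eq_mul_div, div_le_one (by positivity)]
    nlinarith
  have hLη : 16 * (2 * C + 2) ^ 2 * η ^ 2 ≤ 1 := by
    have : 16 * (2 * C + 2) ^ 2 * η ^ 2 = 1 / (C + 1) ^ 2 := by
      rw [hη]; field_simp; norm_num
    rw [this, div_le_one (by positivity)]
    nlinarith
  have hcu := hu.continuousOn_slab hh.continuous h0 hTδ
  have hcv := hv.continuousOn_slab hh.continuous h0 hTδ
  obtain ⟨r, hr, hball⟩ := Metric.eventually_nhds_iff_ball.1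
    ((eventually_close hT hcu (half_pos hη0)).and (eventually_close hT hcv (half_pos hη0)))
  set t₁ := min (t₀ + r / 2) (min y T) with ht₁
  have h01 : t₀ < t₁ := lt_min (by linarith) (lt_min hy hT)
  have h1y : t₁ ≤ y := (min_le_right _ _).trans (min_le_left _ _)
  have h1T : t₁ ≤ T := (min_le_right _ _).trans (min_le_right _ _)
  have h1r : t₁ ≤ t₀ + r / 2 := min_le_left _ _
  have hδ : ∀ t ≤ t₁, (t : EReal) < δ := fun t ht ↦
    (EReal.coe_le_coe_iff.2 (ht.trans h1T)).trans_lt hTδ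
  have hclose : ∀ t ∈ Icc t₀ t₁, (∀ x, ‖h (u x t) - h (u x t₀)‖ ≤ η / 2) ∧
      ∀ x, ‖h (v x t) - h (v x t₀)‖ ≤ η / 2 := by
    intro t ht
    have hb := hball t (by
      rw [Metric.mem_ball, Real.dist_eq, abs_lt]
      constructor <;> linarith [ht.1, ht.2])
    have htT : t ∈ Icc t₀ T := ⟨ht.1, ht.2.trans h1T⟩
    exact ⟨hb.1 htT, hb.2 htT⟩
  have hup : ∀ x, ‖h (u x t₀) - h (u x t₁)‖ ≤ η / 2 := fun x ↦ by
    rw [norm_sub_rev]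
    exact (hclose t₁ ⟨h01.le, le_rfl⟩).1 x
  obtain ⟨C', hC'⟩ := hu.exists_norm_tensionImage_le hh (h0.trans_lt h01) (hδ t₁ le_rfl)
  have hsub : (univ : Set M) ×ˢ Icc t₀ t₁ ⊆ univ ×ˢ Icc t₀ T :=
    prod_mono le_rfl (Icc_subset_Icc le_rfl h1T)
  refine ⟨t₁, ⟨h01, h1y⟩, fun x ↦ hinj ?_⟩
  -- The reference map is the slice of `u` at the right end: `t₁ > 0` even when `t₀ = 0`, so it is
  -- smooth with bounded tension. Both solutions stay within `η / 2` of the common slice at `t₀`,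
  -- hence within `η` of this one.
  refine eq_of_close (p := fun x ↦ u x t₁) H hh hC hCη hLη
    (fun t ht ↦ hu.contMDiff_slice (h0.trans_lt ht.1) (hδ t ht.2))
    (fun t ht ↦ hv.contMDiff_slice (h0.trans_lt ht.1) (hδ t ht.2))
    (hu.contMDiff_slice (h0.trans_lt h01) (hδ t₁ le_rfl))
    (fun x t ht ↦ hu.hasDerivAt hh x (h0.trans_lt ht.1) (hδ t ht.2))
    (fun x t ht ↦ hv.hasDerivAt hh x (h0.trans_lt ht.1) (hδ t ht.2))
    (hcu.mono hsub) (hcv.mono hsub) (fun x t ht ↦ ?_) (fun x t ht ↦ ?_) heq hC' x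
    ⟨h01.le, le_rfl⟩
  · linarith [norm_sub_le_norm_sub_add_norm_sub (h (u x t)) (h (u x t₀)) (h (u x t₁)),
      (hclose t ht).1 x, hup x]
  · have h1 := (hclose t ht).2 x
    rw [← heq] at h1
    linarith [norm_sub_le_norm_sub_add_norm_sub (h (v x t)) (h (u x t₀)) (h (u x t₁)), hup x]

/-- Continuous induction on `[0, T]`: the times at which the two maps agree everywhere form a closed
set containing `0`, and every such time before `T` is followed by others arbitrarily close to it. -/
theorem IsHeatFlow.eq_of_embedding [CompactSpace M] (hu : IsHeatFlow F H δ φ u)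
    (hv : IsHeatFlow F H δ φ v) {h : N → W} (hh : ContMDiff 𝓘(ℝ, F) 𝓘(ℝ, W) ∞ h)
    (hinj : Function.Injective h) {C : ℝ} (hC : HessBound (F := F) h C) (x : M) {T : ℝ}
    (h0 : 0 ≤ T) (hT : (T : EReal) < δ) : u x T = v x T := by
  have hslice : ∀ {w : M → ℝ → N}, IsHeatFlow F H δ φ w → ∀ y,
      ContinuousOn (fun t ↦ h (w y t)) (Icc 0 T) := fun hw y ↦
    (hw.continuousOn_slab hh.continuous le_rfl hT).comp
      (continuous_const.prodMk continuous_id).continuousOn fun _ ht ↦ ⟨mem_univ _, ht⟩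
  have hcl : IsClosed ({t | ∀ y, u y t = v y t} ∩ Icc 0 T) := by
    have h1 : {t | ∀ y, u y t = v y t} ∩ Icc 0 T =
        Icc 0 T ∩ ⋂ y, (Icc 0 T ∩ (fun t ↦ h (u y t) - h (v y t)) ⁻¹' {0}) := by
      ext t
      simp only [mem_inter_iff, mem_iInter, mem_preimage, mem_singleton_iff, sub_eq_zero,
        hinj.eq_iff, mem_ofPred_eq]
      exact ⟨fun h ↦ ⟨h.2, fun y ↦ ⟨h.2, h.1 y⟩⟩, fun h ↦ ⟨fun y ↦ (h.2 y).2, h.1⟩⟩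
    rw [h1]
    exact isClosed_Icc.inter (isClosed_iInter fun y ↦
      ((hslice hu y).sub (hslice hv y)).preimage_isClosed_of_isClosed isClosed_Icc
        isClosed_singleton)
  refine hcl.Icc_subset_of_forall_exists_gt (fun y ↦ by rw [hu.initial, hv.initial]) ?_
    (show T ∈ Icc 0 T from ⟨h0, le_rfl⟩) x
  rintro t ⟨ht, ht0, htT⟩ y hy
  obtain ⟨t₁, ht₁, h1⟩ := hu.exists_eq_later hv hh hinj hC ht0 htT hT hy ht
  exact ⟨t₁, h1, ht₁⟩

-- Whitney's embedding theorem for compact manifolds. Any embedding will do, because the Hessian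
-- accounts for the metric of `N`.
variable (F N) in
theorem exists_embedding_hessBound [CompactSpace N] [T2Space N] :
    ∃ (n : ℕ) (h : N → EuclideanSpace ℝ (Fin n)) (C : ℝ),
      ContMDiff 𝓘(ℝ, F) 𝓘(ℝ, EuclideanSpace ℝ (Fin n)) ∞ h ∧ Function.Injective h ∧
        HessBound (F := F) h C := by
  obtain ⟨n, h, hh, hemb, hd⟩ := exists_embedding_euclidean_of_compact (I := 𝓘(ℝ, F)) (M := N)
  obtain ⟨C, hC⟩ := exists_hess_bounds hh (fun y ↦ hd y) hemb.injective
  exact ⟨n, h, C, hh, hemb.injective, hC⟩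

end Flow

end SubRiem

theorem theorem5p2
    {E : Type*} [NormedAddCommGroup E] [NormedSpace ℝ E] [FiniteDimensional ℝ E]
    {M : Type*} [TopologicalSpace M] [ChartedSpace E M] [IsManifold 𝓘(ℝ, E) ∞ M]
    [T2Space M] [CompactSpace M] [ConnectedSpace M]
    [RiemannianBundle (fun x : M ↦ TangentSpace 𝓘(ℝ, E) x)]
    [IsContMDiffRiemannianBundle 𝓘(ℝ, E) ∞ E (fun x : M ↦ TangentSpace 𝓘(ℝ, E) x)]
    (H : SubRiem.HorizontalDistribution E M)
    {F : Type*} [NormedAddCommGroup F] [NormedSpace ℝ F] [FiniteDimensional ℝ F]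
    {N : Type*} [TopologicalSpace N] [ChartedSpace F N] [IsManifold 𝓘(ℝ, F) ∞ N]
    [T2Space N] [CompactSpace N]
    [RiemannianBundle (fun y : N ↦ TangentSpace 𝓘(ℝ, F) y)]
    [IsContMDiffRiemannianBundle 𝓘(ℝ, F) ∞ F (fun y : N ↦ TangentSpace 𝓘(ℝ, F) y)]
    (δ : EReal) (φ : M → N) (hφ : ContMDiff 𝓘(ℝ, E) 𝓘(ℝ, F) ∞ φ)
    (u v : M → ℝ → N)
    (hu : SubRiem.IsHeatFlow F H δ φ u) (hv : SubRiem.IsHeatFlow F H δ φ v) :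
    ∀ (x : M) (t : ℝ), 0 ≤ t → (t : EReal) < δ → u x t = v x t := by
  obtain ⟨n, h, C, hh, hinj, hC⟩ := SubRiem.exists_embedding_hessBound F N
  exact fun x t h0 ht ↦ hu.eq_of_embedding hv hh hinj hC x h0 ht
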